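/- Let $K$ be a commutative $\mathbb Q$-algebra, $n\ge 0$, and let $z=(z_1,\dots,z_n)$ be either noncommutative or commutative free variables. Write $K\langle\langle z\rangle\rangle$ for the $K$-algebra of formal power series in $z$ (so $K\langle\langle z\rangle\rangle=K[[z]]$ if the variables commute), and let $t$ be a central parameter. For $\vec u=(u_1,\dots,u_n)\in K\langle\langle z\rangle\rangle^{n}$ let $\left[\vec u\,\frac{\partial}{\partial z}\right]$ denote the $K$-derivation of $K\langle\langle z\rangle\rangle$ that sends $z_i$ to $u_i$ for every $i$; the same notation is used over $K[[t]]$. Let $H=(H_1,\dots,H_n)\in K\langle\langle z\rangle\rangle^{n}$ have zero constant terms and put $F_t(z)=z-tH(z)$. Then $F_t$ has a unique inverse $G_t\in K[[t]]\langle\langle z\rangle\rangle^{n}$ with zero constant terms, i.e. $G_t(F_t(z))=z=F_t(G_t(z))$, and it has the form $G_t(z)=z+\sum_{m\ge1}t^mN_{[m]}(z)$ with $N_{[m]}(z)\in K\langle\langle z\rangle\rangle^{n}$. Let $\psi_k$ $(k\ge1)$ be the differential operators on $K\langle\langle z\rangle\rangle$ defined by $$\Big[\tfrac{\partial M_t}{\partial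 t}(F_t)\,\tfrac{\partial}{\partial z}\Big]=\sum_{k\ge1}t^{k-1}\psi_k,\qquad M_t(z)=G_t(z)-z .$$ Then, for every $m\ge1$, $$N_{[m]}(z)=\sum_{I\in\mathcal C_m}\frac1{\pi_u(I)}\,\psi^I z,$$ where $\mathcal C_m$ is the set of compositions $I=(i_1,\dots,i_\ell)$ of $m$ into positive integers, $\psi^I=\psi_{i_1}\psi_{i_2}\cdots\psi_{i_\ell}$ (composition of operators, applied to each $z_i$), and $\pi_u(I)=\prod_{j=1}^{\ell}(i_1+\cdots+i_j)$. Moreover, for every $k\ge1$, $$\psi_k=\Big[C_k(z)\,\tfrac{\partial}{\partial z}\Big],\qquad C_1=H,\quad C_k=\Big[C_{k-1}\,\tfrac{\partial}{\partial z}\Big]H\ \ (k\ge2),$$ and, when the variables $z$ commute, also $\psi_k=\left[\big((JH)^{k-1}H\big)\frac{\partial}{\partial z}\right]$, where $JH=(\partial H_i/\partial z_j)_{i,j}$ is the Jacobian matrix. -/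

import Mathlib

/-- The product `π_u(I) = ∏_{j=1}^{ℓ(I)} (i₁ + ⋯ + i_j)` of a composition `I = (i₁, …, i_ℓ)`. -/
def Composition.piU {m : ℕ} (I : Composition m) : ℕ :=
  ∏ j ∈ Finset.Icc 1 I.length, I.sizeUpTo j

/-- The algebra `R⟨⟨z⟩⟩` of formal power series in noncommutative free variables `z_i`, `i : σ`,
over `R`: a series is the family of its coefficients at the words in the variables. -/
def NCPowerSeries (σ : Type*) (R : Type*) : Type _ := List σ → R

namespace NCPowerSeries

section Basic

variable {σ : Type*} {R : Type*}

/-- The series with coefficients `a`. -/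
def mk (a : List σ → R) : NCPowerSeries σ R := a

/-- The coefficient of `f` at the word `w`. -/
def coeff (w : List σ) (f : NCPowerSeries σ R) : R := f w

@[ext] theorem ext {f g : NCPowerSeries σ R} (h : ∀ w, coeff w f = coeff w g) : f = g := funext h

@[simp] theorem coeff_mk (a : List σ → R) (w : List σ) : coeff w (mk a) = a w := rfl

/-- The constant term. -/
def constantCoeff (f : NCPowerSeries σ R) : R := coeff [] f

/-- The series whose coefficient at `w` is that of `f` at `a ++ w`. -/
def shift (a : List σ) (f : NCPowerSeries σ R) : NCPowerSeries σ R := mk fun w => coeff (a ++ w) f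

@[simp] theorem coeff_shift (a : List σ) (f : NCPowerSeries σ R) (w : List σ) :
    coeff w (shift a f) = coeff (a ++ w) f := rfl

end Basic

section Ring

variable {σ : Type*} {R : Type*} [CommRing R]

instance : AddCommGroup (NCPowerSeries σ R) := inferInstanceAs (AddCommGroup (List σ → R))

instance {S : Type*} [Semiring S] [Module S R] : Module S (NCPowerSeries σ R) :=
  inferInstanceAs (Module S (List σ → R))

instance {S T : Type*} [Semiring S] [Semiring T] [Module S R] [Module T R] [SMul S T]
    [IsScalarTower S T R] : IsScalarTower S T (NCPowerSeries σ R) :=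
  inferInstanceAs (IsScalarTower S T (List σ → R))

@[simp] theorem coeff_add (f g : NCPowerSeries σ R) (w : List σ) :
    coeff w (f + g) = coeff w f + coeff w g := rfl

@[simp] theorem coeff_zero (w : List σ) : coeff w (0 : NCPowerSeries σ R) = 0 := rfl

@[simp] theorem coeff_smul {S : Type*} [Semiring S] [Module S R] (c : S) (f : NCPowerSeries σ R)
    (w : List σ) : coeff w (c • f) = c • coeff w f := rfl

@[simp] theorem coeff_sum {ι : Type*} (s : Finset ι) (F : ι → NCPowerSeries σ R) (w : List σ) :
    coeff w (∑ i ∈ s, F i) = ∑ i ∈ s, coeff w (F i) := Finset.sum_apply w s F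

open Classical in
noncomputable instance : One (NCPowerSeries σ R) := ⟨mk fun w => if w = [] then 1 else 0⟩

/-- The coefficient of `f * g` at `w` is the sum of `f_a * g_b` over all factorizations
`w = a ++ b`. -/
instance : Mul (NCPowerSeries σ R) :=
  ⟨fun f g => mk fun w =>
    ∑ k ∈ Finset.range (w.length + 1), coeff (w.take k) f * coeff (w.drop k) g⟩

theorem coeff_mul (f g : NCPowerSeries σ R) (w : List σ) :
    coeff w (f * g) =
      ∑ k ∈ Finset.range (w.length + 1), coeff (w.take k) f * coeff (w.drop k) g := rfl

open Classical in
theorem coeff_one (w : List σ) : coeff w (1 : NCPowerSeries σ R) = if w = [] then 1 else 0 := rfl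

@[simp] theorem coeff_one_nil : coeff [] (1 : NCPowerSeries σ R) = 1 := by simp [coeff_one]

@[simp] theorem coeff_one_cons (x : σ) (w : List σ) :
    coeff (x :: w) (1 : NCPowerSeries σ R) = 0 := by simp [coeff_one]

@[simp] theorem coeff_mul_nil (f g : NCPowerSeries σ R) :
    coeff [] (f * g) = coeff [] f * coeff [] g := by
  simp [coeff_mul]

theorem coeff_mul_cons (f g : NCPowerSeries σ R) (x : σ) (w : List σ) :
    coeff (x :: w) (f * g) = coeff [] f * coeff (x :: w) g + coeff w (shift [x] f * g) := by
  rw [coeff_mul, List.length_cons, Finset.sum_range_succ', coeff_mul]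
  simp [add_comm]

protected theorem left_distrib (f g h : NCPowerSeries σ R) : f * (g + h) = f * g + f * h := by
  ext w
  simp [coeff_mul, mul_add, Finset.sum_add_distrib]

protected theorem right_distrib (f g h : NCPowerSeries σ R) : (f + g) * h = f * h + g * h := by
  ext w
  simp [coeff_mul, add_mul, Finset.sum_add_distrib]

protected theorem smul_mul (c : R) (f g : NCPowerSeries σ R) : (c • f) * g = c • (f * g) := by
  ext w
  simp [coeff_mul, Finset.mul_sum, mul_assoc]

protected theorem mul_smul' (c : R) (f g : NCPowerSeries σ R) : f * (c • g) = c • (f * g) := by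
  ext w
  simp [coeff_mul, Finset.mul_sum, mul_left_comm]

protected theorem zero_mul' (f : NCPowerSeries σ R) : 0 * f = 0 := by
  ext w
  simp [coeff_mul]

protected theorem mul_zero' (f : NCPowerSeries σ R) : f * 0 = 0 := by
  ext w
  simp [coeff_mul]

theorem shift_mul (x : σ) (f g : NCPowerSeries σ R) :
    shift [x] (f * g) = coeff [] f • shift [x] g + shift [x] f * g := by
  ext w
  simp [coeff_mul_cons]

protected theorem mul_assoc' (f g h : NCPowerSeries σ R) : f * g * h = f * (g * h) := by
  ext w
  induction w generalizing f with
  | nil => simp [mul_assoc]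
  | cons x w ih =>
    rw [coeff_mul_cons, shift_mul, NCPowerSeries.right_distrib, coeff_add, ih, coeff_mul_cons,
      coeff_mul_cons, NCPowerSeries.smul_mul]
    simp
    ring

protected theorem one_mul' (f : NCPowerSeries σ R) : 1 * f = f := by
  ext w
  cases w with
  | nil => simp
  | cons x w =>
    have : shift [x] (1 : NCPowerSeries σ R) = 0 := by
      ext w
      simp [-List.singleton_append, coeff_one]
    simp [coeff_mul_cons, this, NCPowerSeries.zero_mul']

protected theorem mul_one' (f : NCPowerSeries σ R) : f * 1 = f := by
  ext w
  induction w generalizing f with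
  | nil => simp
  | cons x w ih => simp [coeff_mul_cons, ih]

noncomputable instance : Ring (NCPowerSeries σ R) :=
  { (inferInstance : AddCommGroup (NCPowerSeries σ R)) with
    mul := (· * ·)
    one := 1
    left_distrib := NCPowerSeries.left_distrib
    right_distrib := NCPowerSeries.right_distrib
    zero_mul := NCPowerSeries.zero_mul'
    mul_zero := NCPowerSeries.mul_zero'
    mul_assoc := NCPowerSeries.mul_assoc'
    one_mul := NCPowerSeries.one_mul'
    mul_one := NCPowerSeries.mul_one' }

noncomputable instance : Algebra R (NCPowerSeries σ R) :=
  Algebra.ofModule NCPowerSeries.smul_mul NCPowerSeries.mul_smul'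

open Classical in
/-- The variable `z_i`. -/
noncomputable def X (i : σ) : NCPowerSeries σ R := mk fun w => if w = [i] then 1 else 0

end Ring

section Operators

variable {σ : Type*} [Fintype σ] {R : Type*} [CommRing R]

/-- The derivation `[u ∂/∂z] = ∑ i, [u_i ∂/∂z_i]` of `R⟨⟨z⟩⟩`: the one that sends `z_i` to `u_i`.
It replaces, in turn, each occurrence of each letter `z_i` in a word by the series `u_i`, so its
coefficient at `w` is the sum of `(u_i)_s * f_{a ++ i :: b}` over all letters `i` and all
factorizations `w = a ++ s ++ b`. Below, `k` is the length of `a`, and the product in `R⟨⟨z⟩⟩`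
sums over the factorizations `s ++ b` of the rest of `w`. -/
noncomputable def der (u : σ → NCPowerSeries σ R) : Module.End R (NCPowerSeries σ R) where
  toFun f := mk fun w => ∑ k ∈ Finset.range (w.length + 1), ∑ i,
    coeff (w.drop k) (u i * shift (w.take k ++ [i]) f)
  map_add' f g := by
    ext w
    have (a : List σ) : shift a (f + g) = shift a f + shift a g := rfl
    simp [this, mul_add, Finset.sum_add_distrib]
  map_smul' c f := by
    ext w
    have (a : List σ) : shift a (c • f) = c • shift a f := rfl
    simp [this, Finset.mul_sum]

theorem coeff_der (u : σ → NCPowerSeries σ R) (f : NCPowerSeries σ R) (w : List σ) :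
    coeff w (der u f) = ∑ k ∈ Finset.range (w.length + 1), ∑ i,
      coeff (w.drop k) (u i * shift (w.take k ++ [i]) f) := rfl

theorem coeff_der_nil (u : σ → NCPowerSeries σ R) (f : NCPowerSeries σ R) :
    coeff [] (der u f) = ∑ i, coeff [] (u i) * coeff [i] f := by
  simp [coeff_der]

theorem coeff_der_cons (u : σ → NCPowerSeries σ R) (f : NCPowerSeries σ R) (x : σ) (w : List σ) :
    coeff (x :: w) (der u f) =
      coeff (x :: w) (∑ i, u i * shift [i] f) + coeff w (der u (shift [x] f)) := by
  rw [coeff_der, List.length_cons, Finset.sum_range_succ', add_comm, coeff_sum]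
  simp only [List.take_zero, List.drop_zero, List.nil_append]
  rfl

/-- The Leibniz rule. -/
theorem der_mul (u : σ → NCPowerSeries σ R) (f g : NCPowerSeries σ R) :
    der u (f * g) = der u f * g + f * der u g := by
  ext w
  induction w generalizing f with
  | nil =>
    simp only [coeff_der_nil, coeff_add, coeff_mul_nil, coeff_mul_cons, coeff_shift, Finset.sum_mul,
      Finset.mul_sum, ← Finset.sum_add_distrib]
    refine Finset.sum_congr rfl fun i _ => ?_
    simp
    ring
  | cons x w ih =>
    have hs : shift [x] (der u f) = shift [x] (∑ i, u i * shift [i] f) + der u (shift [x] f) := by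
      ext w
      simp [coeff_der_cons]
    have e1 : ∑ i, u i * shift [i] (f * g)
        = coeff [] f • ∑ i, u i * shift [i] g + (∑ i, u i * shift [i] f) * g := by
      rw [Finset.sum_mul, Finset.smul_sum, ← Finset.sum_add_distrib]
      refine Finset.sum_congr rfl fun i _ => ?_
      rw [shift_mul, mul_add, ← mul_assoc, NCPowerSeries.mul_smul']
    rw [coeff_der_cons, e1, shift_mul, map_add, map_smul]
    simp only [coeff_add, ih, coeff_mul_cons, hs, coeff_der_cons, add_mul, coeff_der_nil, coeff_smul,
      smul_eq_mul, coeff_sum, coeff_mul_nil, coeff_shift, List.append_nil]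
    ring

theorem der_X (u : σ → NCPowerSeries σ R) (i : σ) : der u (X i) = u i := by
  classical
  have h1 (j : σ) : shift [j] (X i : NCPowerSeries σ R) = if j = i then 1 else 0 := by
    ext w
    by_cases hj : j = i <;> cases w <;> simp [X, hj]
  have h2 : der u (1 : NCPowerSeries σ R) = 0 := by
    have := der_mul u (1 : NCPowerSeries σ R) 1
    simpa using this
  ext w
  cases w with
  | nil => simp [coeff_der_nil, X]
  | cons x w =>
    have : der u (if x = i then (1 : NCPowerSeries σ R) else 0) = 0 := by split_ifs <;> simp [h2]
    rw [coeff_der_cons]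
    simp only [h1, this]
    simp

/-- Substitution `u ↦ u(F)`, the series `∑_v u_v F_{v₁} ⋯ F_{v_k}` over all words `v`, for a family
`F` of series *without constant terms*: then only words `v` of length at most the length of `w`
contribute to the coefficient at `w`. -/
noncomputable def subst (F : σ → NCPowerSeries σ R) (u : NCPowerSeries σ R) : NCPowerSeries σ R :=
  mk fun w => ∑ k ∈ Finset.range (w.length + 1), ∑ v : Fin k → σ,
    coeff (List.ofFn v) u * coeff w ((List.ofFn v).map F).prod

/-- `F` and `G` are mutually inverse formal maps without constant terms:
`G(F(z)) = z` and `F(G(z)) = z`. -/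
def IsInverse (F G : σ → NCPowerSeries σ R) : Prop :=
  (∀ i, constantCoeff (F i) = 0) ∧ (∀ i, constantCoeff (G i) = 0) ∧
    (∀ i, subst F (G i) = X i) ∧ (∀ i, subst G (F i) = X i)

end Operators

section Deformation

variable {σ : Type*} {K : Type*} [CommRing K]

open scoped PowerSeries

/-- The inclusion `K⟨⟨z⟩⟩ → K[[t]]⟨⟨z⟩⟩`. -/
noncomputable def incl : NCPowerSeries σ K →ₗ[K] NCPowerSeries σ K⟦X⟧ where
  toFun f := mk fun w => PowerSeries.C (coeff w f)
  map_add' f g := by ext w : 1; simp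
  map_smul' c f := by ext w : 1; simp [PowerSeries.smul_eq_C_mul]

/-- The coefficient of `t ^ m` of an element of `K[[t]]⟨⟨z⟩⟩`, an element of `K⟨⟨z⟩⟩`. -/
noncomputable def tCoeff (m : ℕ) : NCPowerSeries σ K⟦X⟧ →ₗ[K] NCPowerSeries σ K where
  toFun f := mk fun w => PowerSeries.coeff m (coeff w f)
  map_add' f g := by ext w; simp
  map_smul' c f := by ext w; simp

/-- The derivative `∂/∂t` on `K[[t]]⟨⟨z⟩⟩`. -/
noncomputable def tDeriv (f : NCPowerSeries σ K⟦X⟧) : NCPowerSeries σ K⟦X⟧ :=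
  mk fun w => PowerSeries.derivative K (coeff w f)

/-- The formal map `F_t(z) = z - t H(z)` over `K[[t]]`. -/
noncomputable def deform (H : σ → NCPowerSeries σ K) : σ → NCPowerSeries σ K⟦X⟧ :=
  fun i => X i - (PowerSeries.X : K⟦X⟧) • incl (H i)

variable [Fintype σ]

/-- The derivation `h(t) = [(∂M_t/∂t)(F_t) ∂/∂z]` of `K[[t]]⟨⟨z⟩⟩`, where `G_t(z) = z + M_t(z)`
is the inverse of `F_t`. -/
noncomputable def hOp (F G : σ → NCPowerSeries σ K⟦X⟧) : Module.End K⟦X⟧ (NCPowerSeries σ K⟦X⟧) :=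
  der fun i => subst F (tDeriv (G i - X i))

/-- The differential operators `ψ_m`, `m ≥ 1`, on `K⟨⟨z⟩⟩`, defined by
`h(t) = ∑_{m ≥ 1} t ^ (m - 1) ψ_m`. -/
noncomputable def psi (F G : σ → NCPowerSeries σ K⟦X⟧) (m : ℕ) : Module.End K (NCPowerSeries σ K) :=
  tCoeff (m - 1) ∘ₗ (hOp F G).restrictScalars K ∘ₗ incl

/-- `Cvec H k` is the vector `C_{k+1}(z)` where `C_1 = H` and `C_k = [C_{k-1} ∂/∂z] H`. -/
noncomputable def Cvec (H : σ → NCPowerSeries σ K) : ℕ → σ → NCPowerSeries σ K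
  | 0 => H
  | k + 1 => fun i => der (Cvec H k) (H i)

end Deformation

end NCPowerSeries

/-! The same notions for commutative variables. -/

namespace CommSeries

variable {σ : Type*} [Fintype σ]

/-- The derivation `[u ∂/∂z] = ∑ i, u_i ∂/∂z_i` of `R[[z]]`. -/
noncomputable def der {R : Type*} [CommRing R] (u : σ → MvPowerSeries σ R) :
    Module.End R (MvPowerSeries σ R) :=
  ∑ i, u i • (MvPowerSeries.pderiv R i).toLinearMap

/-- `F` and `G` are mutually inverse formal maps without constant terms:
`G(F(z)) = z` and `F(G(z)) = z`. -/
def IsInverse {R : Type*} [CommRing R] (F G : σ → MvPowerSeries σ R) : Prop :=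
  (∀ i, MvPowerSeries.constantCoeff (F i) = 0) ∧ (∀ i, MvPowerSeries.constantCoeff (G i) = 0) ∧
    (∀ i, MvPowerSeries.subst F (G i) = MvPowerSeries.X i) ∧
    (∀ i, MvPowerSeries.subst G (F i) = MvPowerSeries.X i)

variable {K : Type*} [CommRing K]

open scoped PowerSeries

/-- The inclusion `K[[z]] → K[[t]][[z]]`. -/
noncomputable def incl : MvPowerSeries σ K →ₗ[K] MvPowerSeries σ K⟦X⟧ where
  toFun f := MvPowerSeries.map PowerSeries.C f
  map_add' f g := by simp
  map_smul' c f := by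
    ext1 e
    simp [PowerSeries.smul_eq_C_mul]

/-- The coefficient of `t ^ m` of an element of `K[[t]][[z]]`, an element of `K[[z]]`. -/
noncomputable def tCoeff (m : ℕ) : MvPowerSeries σ K⟦X⟧ →ₗ[K] MvPowerSeries σ K where
  toFun f := fun e => PowerSeries.coeff m (MvPowerSeries.coeff e f)
  map_add' f g := by
    funext e
    exact map_add (PowerSeries.coeff m) (MvPowerSeries.coeff e f) (MvPowerSeries.coeff e g)
  map_smul' c f := by
    funext e
    exact map_smul (PowerSeries.coeff m) c (MvPowerSeries.coeff e f)

/-- The derivative `∂/∂t` on `K[[t]][[z]]`. -/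
noncomputable def tDeriv (f : MvPowerSeries σ K⟦X⟧) : MvPowerSeries σ K⟦X⟧ :=
  fun e => PowerSeries.derivative K (MvPowerSeries.coeff e f)

/-- The formal map `F_t(z) = z - t H(z)` over `K[[t]]`. -/
noncomputable def deform (H : σ → MvPowerSeries σ K) : σ → MvPowerSeries σ K⟦X⟧ :=
  fun i => MvPowerSeries.X i - (PowerSeries.X : K⟦X⟧) • incl (H i)

/-- The derivation `h(t) = [(∂M_t/∂t)(F_t) ∂/∂z]` of `K[[t]][[z]]`, where `G_t(z) = z + M_t(z)`
is the inverse of `F_t`. -/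
noncomputable def hOp (F G : σ → MvPowerSeries σ K⟦X⟧) : Module.End K⟦X⟧ (MvPowerSeries σ K⟦X⟧) :=
  der fun i => MvPowerSeries.subst F (tDeriv (G i - MvPowerSeries.X i))

/-- The differential operators `ψ_m`, `m ≥ 1`, on `K[[z]]`, defined by
`h(t) = ∑_{m ≥ 1} t ^ (m - 1) ψ_m`. -/
noncomputable def psi (F G : σ → MvPowerSeries σ K⟦X⟧) (m : ℕ) : Module.End K (MvPowerSeries σ K) :=
  tCoeff (m - 1) ∘ₗ (hOp F G).restrictScalars K ∘ₗ incl

/-- `Cvec H k` is the vector `C_{k+1}(z)` where `C_1 = H` and `C_k = [C_{k-1} ∂/∂z] H`. -/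
noncomputable def Cvec (H : σ → MvPowerSeries σ K) : ℕ → σ → MvPowerSeries σ K
  | 0 => H
  | k + 1 => fun i => der (Cvec H k) (H i)

/-- The Jacobian matrix `JH = (∂H_i/∂z_j)`. -/
noncomputable def jacobian (H : σ → MvPowerSeries σ K) : Matrix σ σ (MvPowerSeries σ K) :=
  Matrix.of fun i j => MvPowerSeries.pderiv K j (H i)

end CommSeries

/-! Write U_t for the substitution f ↦ f(G_t) and u = (∂M_t/∂t)(F_t), so that u(G_t) = ∂G_t/∂t. The
chain rule gives the flow equation ∂/∂t (U_t f) = U_t([u ∂/∂z] f) for f free of t. With U_t = ∑ t^m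
B_m on such f, comparing coefficients gives (m+1) B_{m+1} = ∑_{j≤m} B_j ψ_{m+1-j}, B_0 = 1.
Unrolling this recursion adds one last block at a time, each time dividing by the total reached, and
so produces the sum over compositions with denominators π_u(I) (`Composition.sum_piU_of_recursion`).
Evaluation at z_i gives N_[m].

For the ψ_k, differentiate G = z + tH(G): ∂G/∂t = (H + t[u ∂/∂z]H)(G). Since substitution of G is
injective, u = H + t[u ∂/∂z]H (`SeriesModel.IsInverse.field_eq`), and the coefficients of u satisfy
the recursion of the C_k. In commuting variables [C ∂/∂z]H = JH·C.

Both kinds of variables are treated at once through `SeriesModel`. Every series is c + ∑ z_i g_i, so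
the defect Δ of a desired identity satisfies Δ(f) = ∑ y_i Δ(g_i) with y_i of positive order in z;
iteration puts Δ(f) in every order, hence Δ = 0 (`eq_zero_of_contracting`). The same argument modulo
t^m makes the iteration for G = z + tH(G) converge. -/

/-! ### Compositions and the recursion that they solve. -/

/-- Every composition of `m > 0` is obtained uniquely by appending a last block `m - j` to a
composition of some `j < m`. -/
theorem Composition.sum_univ_eq_sum_concat {M : Type*} [AddCommMonoid M] {m : ℕ} (hm : 0 < m)
    (f : List ℕ → M) :
    ∑ I : Composition m, f I.blocks =
      ∑ j ∈ Finset.range m, ∑ J : Composition j, f (J.blocks ++ [m - j]) := by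
  rw [Finset.sum_sigma']
  symm
  refine Finset.sum_bij
    (fun p hp => ⟨p.2.blocks ++ [m - p.1], ?_, ?_⟩) ?_ ?_ ?_ ?_
  · intro i hi
    have := Finset.mem_range.1 (Finset.mem_sigma.1 hp).1
    rcases List.mem_append.1 hi with h | h
    · exact p.2.blocks_pos h
    · rw [List.mem_singleton] at h
      omega
  · have := Finset.mem_range.1 (Finset.mem_sigma.1 hp).1
    rw [List.sum_append, p.2.blocks_sum, List.sum_singleton]
    omega
  · simp
  · rintro ⟨j, J⟩ hp ⟨j', J'⟩ hp' h
    have h1 := congrArg Composition.blocks h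
    obtain ⟨hb, hl⟩ := List.append_inj' h1 rfl
    have hj : j = j' := by rw [← J.blocks_sum, ← J'.blocks_sum, hb]
    subst hj
    rw [show J = J' from Composition.ext hb]
  -- Surjectivity: since `m > 0` the list of blocks is nonempty, and its last block can be split
  -- off.
  · intro I _
    rcases List.eq_nil_or_concat I.blocks with h | ⟨L, b, h⟩
    · have := I.blocks_sum
      rw [h, List.sum_nil] at this
      omega
    · rw [List.concat_eq_append] at h
      have hs : L.sum + b = m := by rw [← I.blocks_sum, h]; simp
      have hb : 0 < b := I.blocks_pos (by rw [h]; simp)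
      refine ⟨⟨L.sum, ⟨L, fun hi => I.blocks_pos (by rw [h]; simp [hi]), rfl⟩⟩, ?_, ?_⟩
      · simp
        omega
      · apply Composition.ext
        refine Eq.trans ?_ h.symm
        change L ++ [m - L.sum] = L ++ [b]
        rw [show m - L.sum = b by omega]
  · intros
    rfl

/-- This form depends on the list of blocks alone, as the splitting of the last block requires. -/
theorem Composition.piU_eq {m : ℕ} (I : Composition m) :
    I.piU = ∏ j ∈ Finset.range I.blocks.length, (I.blocks.take (j + 1)).sum := by
  rw [Composition.piU, ← Finset.Ico_succ_right_eq_Icc, Finset.prod_Ico_eq_prod_range]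
  simp [Composition.sizeUpTo, add_comm]

/-- The solution of the recursion `m B_m = ∑_{j < m} B_j ψ_{m-j}`, `B_0 = 1`. -/
theorem Composition.sum_piU_of_recursion {K E : Type*} [CommRing K] [Algebra ℚ K] [Ring E]
    [Algebra K E] (ψ B : ℕ → E) (h0 : B 0 = 1)
    (hB : ∀ m : ℕ, ((m : K) + 1) • B (m + 1) = ∑ j ∈ Finset.range (m + 1), B j * ψ (m + 1 - j))
    (m : ℕ) :
    B m = ∑ I : Composition m, algebraMap ℚ K (1 / (I.piU : ℚ)) • (I.blocks.map ψ).prod := by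
  have key (m : ℕ) : ∑ I : Composition m, algebraMap ℚ K (1 / (I.piU : ℚ)) •
      (I.blocks.map ψ).prod = ∑ I : Composition m, (fun L : List ℕ =>
        algebraMap ℚ K (1 / ((∏ j ∈ Finset.range L.length, (L.take (j + 1)).sum : ℕ) : ℚ)) •
          (L.map ψ).prod) I.blocks := by
    simp only [Composition.piU_eq]
  induction m using Nat.strong_induction_on with
  | _ m ih =>
    rcases m with _ | m
    · have hb (I : Composition 0) : I.blocks = [] := by
        have h := I.blocks_sum
        rw [List.sum_eq_zero_iff] at h
        exact List.eq_nil_iff_forall_not_mem.2 fun a ha => (I.blocks_pos ha).ne' (h a ha)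
      simp [Composition.piU_eq, hb, h0, composition_card]
    · rw [key, Composition.sum_univ_eq_sum_concat (Nat.succ_pos m) (fun L : List ℕ =>
        algebraMap ℚ K (1 / ((∏ j ∈ Finset.range L.length, (L.take (j + 1)).sum : ℕ) : ℚ)) •
          (L.map ψ).prod)]
      -- Division by m + 1 in the recursion is where `K` must be a ℚ-algebra.
      have hinv : algebraMap ℚ K (1 / ((m : ℚ) + 1)) * ((m : K) + 1) = 1 := by
        have : ((m : K) + 1) = algebraMap ℚ K ((m : ℚ) + 1) := by simp
        rw [this, ← map_mul, one_div, inv_mul_cancel₀ (by positivity), map_one]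
      rw [← one_smul K (B (m + 1)), ← hinv, mul_smul, hB, Finset.smul_sum]
      refine Finset.sum_congr rfl fun j hj => ?_
      rw [Finset.mem_range] at hj
      rw [ih j hj, Finset.sum_mul, Finset.smul_sum]
      refine Finset.sum_congr rfl fun J _ => ?_
      -- The new list has the partial sums of `J` and one more, the total m + 1.
      have hp : ∏ i ∈ Finset.range (J.blocks ++ [m + 1 - j]).length,
          ((J.blocks ++ [m + 1 - j]).take (i + 1)).sum = J.piU * (m + 1) := by
        rw [List.length_append, List.length_singleton, Finset.prod_range_succ, Composition.piU_eq]
        congr 1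
        · refine Finset.prod_congr rfl fun i hi => ?_
          rw [List.take_append_of_le_length (by simpa using hi)]
        · rw [List.take_of_length_le (by simp), List.sum_append, J.blocks_sum, List.sum_singleton]
          omega
      simp only [Nat.succ_eq_add_one, hp, List.map_append, List.prod_append, List.map_singleton,
        List.prod_singleton]
      rw [smul_mul_assoc, smul_smul, ← map_mul]
      congr 2
      push_cast
      rw [one_div_mul_one_div, mul_comm]

/-! ### The common framework for commuting and noncommuting variables. -/

open scoped PowerSeries

/-- The features of `A = K⟨⟨z⟩⟩` and `T = K[[t]]⟨⟨z⟩⟩` that the inversion of `z - t H(z)` uses; they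
are common to the commutative and the noncommutative variables. -/
structure SeriesModel (σ K A T : Type*) [Fintype σ] [CommRing K] [AddCommGroup A] [Module K A]
    [Ring T] [Module K⟦X⟧ T] where
  /-- The variables. -/
  var : σ → A
  /-- The inclusion of `A` in `T`. -/
  incl : A → T
  /-- The coefficient of `t ^ m`. -/
  coeff : ℕ → T → A
  /-- The derivative with respect to `t`. -/
  deriv : T → T
  /-- The series of order at least `N` in `z`. -/
  fil : ℕ → AddSubgroup T
  /-- The series of order at least `N` in `z`. -/
  filA : ℕ → AddSubgroup A
  /-- Substitution. -/
  subst : (σ → T) → T → T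
  /-- The derivation of `T` with given values at the variables. -/
  der : (σ → T) → T → T
  /-- The derivation of `A` with given values at the variables. -/
  derA : (σ → A) → A → A
  smul_mul : ∀ (c : K⟦X⟧) (f g : T), (c • f) * g = c • (f * g)
  mul_smul : ∀ (c : K⟦X⟧) (f g : T), f * (c • g) = c • (f * g)
  incl_add : ∀ f g, incl (f + g) = incl f + incl g
  incl_smul : ∀ (c : K) f, incl (c • f) = PowerSeries.C c • incl f
  coeff_add : ∀ m f g, coeff m (f + g) = coeff m f + coeff m g
  coeff_C_smul : ∀ m (c : K) f, coeff m (PowerSeries.C c • f) = c • coeff m f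
  coeff_zero_incl : ∀ a, coeff 0 (incl a) = a
  coeff_succ_incl : ∀ m a, coeff (m + 1) (incl a) = 0
  coeff_zero_X_smul : ∀ f, coeff 0 ((PowerSeries.X : K⟦X⟧) • f) = 0
  coeff_succ_X_smul : ∀ m f, coeff (m + 1) ((PowerSeries.X : K⟦X⟧) • f) = coeff m f
  ext : ∀ f g, (∀ m, coeff m f = coeff m g) → f = g
  exists_coeff : ∀ a : ℕ → A, ∃ f, ∀ m, coeff m f = a m
  mem_fil : ∀ N f, f ∈ fil N ↔ ∀ m, coeff m f ∈ filA N
  fil_zero : ∀ f, f ∈ fil 0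
  filA_separated : ∀ a, (∀ N, a ∈ filA N) → a = 0
  fil_mul : ∀ N f g, f ∈ fil 1 → g ∈ fil N → f * g ∈ fil (N + 1)
  fil_smul : ∀ N (c : K⟦X⟧) f, f ∈ fil N → c • f ∈ fil N
  var_mem : ∀ i, incl (var i) ∈ fil 1
  exists_const : ∀ f, ∃ c : K⟦X⟧, f - c • (1 : T) ∈ fil 1
  exists_sum : ∀ f ∈ fil 1, ∃ g : σ → T, f = ∑ i, incl (var i) * g i
  subst_add : ∀ F, (∀ i, F i ∈ fil 1) → ∀ f g, subst F (f + g) = subst F f + subst F g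
  subst_mul : ∀ F, (∀ i, F i ∈ fil 1) → ∀ f g, subst F (f * g) = subst F f * subst F g
  subst_smul : ∀ F, (∀ i, F i ∈ fil 1) → ∀ (c : K⟦X⟧) f, subst F (c • f) = c • subst F f
  subst_one : ∀ F, (∀ i, F i ∈ fil 1) → subst F 1 = 1
  subst_var : ∀ F, (∀ i, F i ∈ fil 1) → ∀ i, subst F (incl (var i)) = F i
  der_add : ∀ u f g, der u (f + g) = der u f + der u g
  der_mul : ∀ u f g, der u (f * g) = der u f * g + f * der u g
  der_smul : ∀ u (c : K⟦X⟧) f, der u (c • f) = c • der u f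
  der_var : ∀ u i, der u (incl (var i)) = u i
  -- [u ∂/∂z] is linear in u, so on series free of t its t-expansion is that of u.
  coeff_der_incl : ∀ m u a, coeff m (der u (incl a)) = derA (fun i => coeff m (u i)) a
  deriv_add : ∀ f g, deriv (f + g) = deriv f + deriv g
  deriv_mul : ∀ f g, deriv (f * g) = deriv f * g + f * deriv g
  deriv_smul : ∀ (c : K⟦X⟧) f, deriv (c • f) = PowerSeries.derivative K c • f + c • deriv f
  coeff_deriv : ∀ m f, coeff m (deriv f) = ((m : K) + 1) • coeff (m + 1) f

namespace SeriesModel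

variable {σ K A T : Type*} [Fintype σ] [CommRing K] [AddCommGroup A] [Module K A]
  [Ring T] [Module K⟦X⟧ T] (M : SeriesModel σ K A T)

/-- The variables of `T`. -/
def X (i : σ) : T := M.incl (M.var i)

/-- The recursion step of all contraction arguments. The `g i` need not be unique; only their
existence is used. -/
theorem exists_decomp (f : T) :
    ∃ (c : K⟦X⟧) (g : σ → T), f = c • (1 : T) + ∑ i, M.X i * g i := by
  obtain ⟨c, hc⟩ := M.exists_const f
  obtain ⟨g, hg⟩ := M.exists_sum _ hc
  exact ⟨c, g, by rw [show ∑ i, M.X i * g i = f - c • (1 : T) from hg.symm]; abel⟩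

/-- The additive map underlying the coefficient of `t ^ m`. -/
def coeffHom (m : ℕ) : T →+ A := AddMonoidHom.mk' (M.coeff m) (M.coeff_add m)

theorem coeff_zero (m : ℕ) : M.coeff m 0 = 0 := (M.coeffHom m).map_zero

theorem coeff_sub (m : ℕ) (f g : T) : M.coeff m (f - g) = M.coeff m f - M.coeff m g :=
  (M.coeffHom m).map_sub f g

theorem coeff_sum {ι : Type*} (s : Finset ι) (m : ℕ) (f : ι → T) :
    M.coeff m (∑ i ∈ s, f i) = ∑ i ∈ s, M.coeff m (f i) := map_sum (M.coeffHom m) f s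

/-- Substitution as an additive map. -/
def substHom (F : σ → T) (hF : ∀ i, F i ∈ M.fil 1) : T →+ T :=
  AddMonoidHom.mk' (M.subst F) (M.subst_add F hF)

/-- The derivation as an additive map. -/
def derHom (u : σ → T) : T →+ T := AddMonoidHom.mk' (M.der u) (M.der_add u)

/-- The derivative in `t` as an additive map. -/
def derivHom : T →+ T := AddMonoidHom.mk' M.deriv M.deriv_add

theorem der_one (u : σ → T) : M.der u 1 = 0 := by
  simpa using M.der_mul u 1 1

theorem deriv_one : M.deriv 1 = 0 := by
  simpa using M.deriv_mul 1 1

theorem deriv_X (i : σ) : M.deriv (M.X i) = 0 := by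
  refine M.ext _ _ fun m => ?_
  rw [M.coeff_deriv, X, M.coeff_succ_incl, smul_zero, M.coeff_zero]

theorem subst_decomp (F : σ → T) (hF : ∀ i, F i ∈ M.fil 1) (c : K⟦X⟧) (g : σ → T) :
    M.subst F (c • (1 : T) + ∑ i, M.X i * g i) =
      c • (1 : T) + ∑ i, F i * M.subst F (g i) := by
  rw [M.subst_add F hF, M.subst_smul F hF, M.subst_one F hF]
  congr 1
  refine (map_sum (M.substHom F hF) _ _).trans (Finset.sum_congr rfl fun i _ => ?_)
  change M.subst F (M.X i * g i) = _
  rw [M.subst_mul F hF, X, M.subst_var F hF]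

theorem der_decomp (u : σ → T) (c : K⟦X⟧) (g : σ → T) :
    M.der u (c • (1 : T) + ∑ i, M.X i * g i) = ∑ i, (u i * g i + M.X i * M.der u (g i)) := by
  rw [M.der_add, M.der_smul, M.der_one, smul_zero, zero_add]
  refine (map_sum (M.derHom u) _ _).trans (Finset.sum_congr rfl fun i _ => ?_)
  change M.der u (M.X i * g i) = _
  rw [M.der_mul, X, M.der_var]

theorem deriv_decomp (c : K⟦X⟧) (F g : σ → T) :
    M.deriv (c • (1 : T) + ∑ i, F i * g i) =
      PowerSeries.derivative K c • (1 : T) + ∑ i, (M.deriv (F i) * g i + F i * M.deriv (g i)) := by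
  rw [M.deriv_add, M.deriv_smul, M.deriv_one, smul_zero, add_zero]
  congr 1
  refine (map_sum M.derivHom _ _).trans (Finset.sum_congr rfl fun i _ => ?_)
  exact M.deriv_mul _ _

/-! ### Calculus modulo powers of t, and the contraction principle. -/

theorem coeff_X_pow_smul_of_lt {m j : ℕ} (hj : j < m) (f : T) :
    M.coeff j ((PowerSeries.X : K⟦X⟧) ^ m • f) = 0 := by
  induction m generalizing j with
  | zero => omega
  | succ m ih =>
    rw [pow_succ', ← smul_smul]
    rcases j with _ | j
    · exact M.coeff_zero_X_smul _
    · rw [M.coeff_succ_X_smul]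
      exact ih (by omega)

theorem coeff_X_pow_smul_add (m j : ℕ) (f : T) :
    M.coeff (m + j) ((PowerSeries.X : K⟦X⟧) ^ m • f) = M.coeff j f := by
  induction m with
  | zero => simp
  | succ m ih =>
    rw [pow_succ', ← smul_smul, show m + 1 + j = m + j + 1 by omega, M.coeff_succ_X_smul, ih]

theorem exists_eq_X_pow_smul {m : ℕ} {f : T} (hf : ∀ j < m, M.coeff j f = 0) :
    ∃ g, f = (PowerSeries.X : K⟦X⟧) ^ m • g := by
  obtain ⟨g, hg⟩ := M.exists_coeff fun j => M.coeff (m + j) f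
  refine ⟨g, M.ext _ _ fun j => ?_⟩
  rcases lt_or_ge j m with h | h
  · rw [hf j h, M.coeff_X_pow_smul_of_lt h]
  · obtain ⟨k, rfl⟩ := Nat.exists_eq_add_of_le h
    rw [M.coeff_X_pow_smul_add, hg]

theorem coeff_mul_eq_zero {m : ℕ} {f : T} (hf : ∀ j < m, M.coeff j f = 0) (g : T) {j : ℕ}
    (hj : j < m) : M.coeff j (f * g) = 0 := by
  obtain ⟨f', rfl⟩ := M.exists_eq_X_pow_smul hf
  rw [M.smul_mul, M.coeff_X_pow_smul_of_lt hj]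

/-- Below t^m the product depends only on `x` modulo t^m, so `x` may be replaced by its truncation
`x₀`, which lies in `fil N` as a whole. -/
theorem coeff_mul_mem {m N : ℕ} {y x : T} (hy : y ∈ M.fil 1)
    (hx : ∀ j < m, M.coeff j x ∈ M.filA N) {j : ℕ} (hj : j < m) :
    M.coeff j (y * x) ∈ M.filA (N + 1) := by
  obtain ⟨x₀, hx₀⟩ := M.exists_coeff fun j => if j < m then M.coeff j x else 0
  have h₀ : x₀ ∈ M.fil N := by
    rw [M.mem_fil]
    intro j
    rw [hx₀]
    split_ifs with h
    · exact hx j h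
    · exact zero_mem _
  obtain ⟨x₁, hx₁⟩ := M.exists_eq_X_pow_smul (m := m) (f := x - x₀) fun j hj => by
    rw [M.coeff_sub, hx₀, if_pos hj, sub_self]
  rw [← sub_add_cancel x x₀, hx₁, mul_add, M.coeff_add, M.mul_smul, M.coeff_X_pow_smul_of_lt hj,
    zero_add]
  exact (M.mem_fil _ _).1 (M.fil_mul N _ _ hy h₀) j

/-- A map that satisfies a contracting linear recursion modulo `t ^ m` vanishes modulo `t ^ m`. -/
theorem coeff_eq_zero_of_contracting {m : ℕ} (Δ : T → T)
    (h : ∀ f, ∃ y g : σ → T, (∀ i, y i ∈ M.fil 1) ∧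
      ∀ j < m, M.coeff j (Δ f) = M.coeff j (∑ i, y i * Δ (g i))) (f : T) {j : ℕ} (hj : j < m) :
    M.coeff j (Δ f) = 0 := by
  -- Each use of the recursion gains one order in z. The statement ranges over all `f` because the
  -- recursion passes to the `g i`.
  have key (N : ℕ) : ∀ f, ∀ j < m, M.coeff j (Δ f) ∈ M.filA N := by
    induction N with
    | zero => exact fun f j _ => (M.mem_fil _ _).1 (M.fil_zero _) j
    | succ N ih =>
      intro f j hj
      obtain ⟨y, g, hy, e⟩ := h f
      rw [e j hj, M.coeff_sum]
      exact sum_mem fun i _ => M.coeff_mul_mem (hy i) (ih (g i)) hj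
  exact M.filA_separated _ fun N => key N f j hj

theorem eq_zero_of_contracting (Δ : T → T)
    (h : ∀ f, ∃ y g : σ → T, (∀ i, y i ∈ M.fil 1) ∧ Δ f = ∑ i, y i * Δ (g i)) (f : T) :
    Δ f = 0 := by
  refine M.ext _ _ fun m => ?_
  rw [M.coeff_zero]
  refine M.coeff_eq_zero_of_contracting (m := m + 1) Δ (fun f => ?_) f (Nat.lt_succ_self m)
  obtain ⟨y, g, hy, e⟩ := h f
  exact ⟨y, g, hy, fun j _ => by rw [e]⟩

theorem subst_mem (F : σ → T) (hF : ∀ i, F i ∈ M.fil 1) {f : T} (hf : f ∈ M.fil 1) :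
    M.subst F f ∈ M.fil 1 := by
  obtain ⟨g, hg⟩ := M.exists_sum f hf
  have := M.subst_decomp F hF 0 g
  rw [zero_smul, zero_add, zero_add] at this
  rw [show f = ∑ i, M.X i * g i from hg, this]
  exact sum_mem fun i _ => M.fil_mul 0 _ _ (hF i) (M.fil_zero _)

/-- Substitutions that agree modulo `t ^ m` at the variables agree modulo `t ^ m`. -/
theorem coeff_subst_congr {m : ℕ} {F F' : σ → T} (hF : ∀ i, F i ∈ M.fil 1)
    (hF' : ∀ i, F' i ∈ M.fil 1) (h : ∀ i, ∀ j < m, M.coeff j (F i) = M.coeff j (F' i)) (f : T)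
    {j : ℕ} (hj : j < m) : M.coeff j (M.subst F f) = M.coeff j (M.subst F' f) := by
  rw [← sub_eq_zero, ← M.coeff_sub]
  refine M.coeff_eq_zero_of_contracting (fun f => M.subst F f - M.subst F' f) (fun f => ?_) f hj
  obtain ⟨c, g, rfl⟩ := M.exists_decomp f
  refine ⟨F', g, hF', fun j hj => ?_⟩
  -- Telescoping F a - F' b = (F - F') a + F' (a - b); the first part vanishes modulo t^m.
  have e : M.subst F (c • (1 : T) + ∑ i, M.X i * g i) -
        M.subst F' (c • (1 : T) + ∑ i, M.X i * g i) =
      ∑ i, (F i - F' i) * M.subst F (g i) +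
        ∑ i, F' i * (M.subst F (g i) - M.subst F' (g i)) := by
    rw [M.subst_decomp F hF, M.subst_decomp F' hF', ← Finset.sum_add_distrib,
      add_sub_add_left_eq_sub, ← Finset.sum_sub_distrib]
    refine Finset.sum_congr rfl fun i _ => ?_
    noncomm_ring
  rw [e, M.coeff_add, M.coeff_sum, Finset.sum_eq_zero, zero_add]
  refine fun i _ => M.coeff_mul_eq_zero (m := m) (fun k hk => ?_) _ hj
  rw [M.coeff_sub, h i k hk, sub_self]

theorem subst_X (f : T) : M.subst M.X f = f := by
  rw [← sub_eq_zero]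
  refine M.eq_zero_of_contracting (fun f => M.subst M.X f - f) (fun f => ?_) f
  obtain ⟨c, g, rfl⟩ := M.exists_decomp f
  refine ⟨M.X, g, M.var_mem, ?_⟩
  rw [M.subst_decomp M.X M.var_mem, add_sub_add_left_eq_sub, ← Finset.sum_sub_distrib]
  simp only [mul_sub]

/-- If `F(G(z)) = z` then `u(F)(G) = u` for all series `u`. -/
theorem subst_subst_of_inverse {F G : σ → T} (hF : ∀ i, F i ∈ M.fil 1) (hG : ∀ i, G i ∈ M.fil 1)
    (h : ∀ i, M.subst G (F i) = M.X i) (f : T) : M.subst G (M.subst F f) = f := by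
  rw [← sub_eq_zero]
  refine M.eq_zero_of_contracting (fun f => M.subst G (M.subst F f) - f) (fun f => ?_) f
  obtain ⟨c, g, rfl⟩ := M.exists_decomp f
  refine ⟨M.X, g, M.var_mem, ?_⟩
  have e : M.subst G (∑ i, F i * M.subst F (g i)) = ∑ i, M.X i * M.subst G (M.subst F (g i)) := by
    refine (map_sum (M.substHom G hG) _ _).trans (Finset.sum_congr rfl fun i _ => ?_)
    change M.subst G (F i * M.subst F (g i)) = _
    rw [M.subst_mul G hG, h]
  rw [M.subst_decomp F hF, M.subst_add G hG, M.subst_smul G hG, M.subst_one G hG, e,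
    add_sub_add_left_eq_sub, ← Finset.sum_sub_distrib]
  simp only [mul_sub]

/-- The chain rule for `∂/∂t`. -/
theorem deriv_subst {G w : σ → T} (hG : ∀ i, G i ∈ M.fil 1)
    (hw : ∀ i, M.subst G (w i) = M.deriv (G i)) (f : T) :
    M.deriv (M.subst G f) = M.subst G (M.deriv f) + M.subst G (M.der w f) := by
  rw [← sub_eq_zero]
  -- The defect of the chain rule vanishes on constants, and on z_i g it is G_i times the defect on
  -- g, because `hw` cancels the terms with ∂G_i/∂t.
  refine M.eq_zero_of_contracting (fun f => M.deriv (M.subst G f) -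
    (M.subst G (M.deriv f) + M.subst G (M.der w f))) (fun f => ?_) f
  obtain ⟨c, g, rfl⟩ := M.exists_decomp f
  refine ⟨G, g, hG, ?_⟩
  have e₁ : M.deriv (c • (1 : T) + ∑ i, M.X i * g i) =
      PowerSeries.derivative K c • (1 : T) + ∑ i, M.X i * M.deriv (g i) := by
    rw [M.deriv_decomp]
    simp only [M.deriv_X, zero_mul, zero_add]
  have e₂ : M.subst G (∑ i, (w i * g i + M.X i * M.der w (g i))) =
      ∑ i, (M.deriv (G i) * M.subst G (g i) + G i * M.subst G (M.der w (g i))) := by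
    refine (map_sum (M.substHom G hG) _ _).trans (Finset.sum_congr rfl fun i _ => ?_)
    change M.subst G (w i * g i + M.X i * M.der w (g i)) = _
    rw [M.subst_add G hG, M.subst_mul G hG, M.subst_mul G hG, hw, X, M.subst_var G hG]
  rw [e₁, M.subst_decomp G hG, M.subst_decomp G hG, M.deriv_decomp, M.der_decomp, e₂, add_assoc,
    add_sub_add_left_eq_sub, ← Finset.sum_add_distrib, ← Finset.sum_sub_distrib]
  refine Finset.sum_congr rfl fun i _ => ?_
  noncomm_ring

/-! ### Existence and uniqueness of the inverse map. -/

/-- A solution `G` of the equation `G = z + t H(G)`. -/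
theorem exists_fixed_point (H : σ → T) (hH : ∀ i, H i ∈ M.fil 1) :
    ∃ G : σ → T, (∀ i, G i ∈ M.fil 1) ∧
      ∀ i, G i = M.X i + (PowerSeries.X : K⟦X⟧) • M.subst G (H i) := by
  -- Picard iteration from the identity map. The factor t makes consecutive iterates `P k`, `P (k +
  -- 1)` agree modulo t^(k+1).
  let P : ℕ → σ → T := fun k => Nat.rec M.X
    (fun _ Q i => M.X i + (PowerSeries.X : K⟦X⟧) • M.subst Q (H i)) k
  have hP0 : P 0 = M.X := rfl
  have hP1 (k : ℕ) (i : σ) :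
      P (k + 1) i = M.X i + (PowerSeries.X : K⟦X⟧) • M.subst (P k) (H i) := rfl
  have hPm (k : ℕ) : ∀ i, P k i ∈ M.fil 1 := by
    induction k with
    | zero => exact M.var_mem
    | succ k ih =>
      intro i
      rw [hP1]
      exact add_mem (M.var_mem i) (M.fil_smul _ _ _ (M.subst_mem _ ih (hH i)))
  have step (k : ℕ) : ∀ i, ∀ j < k + 1, M.coeff j (P k i) = M.coeff j (P (k + 1) i) := by
    induction k with
    | zero =>
      intro i j hj
      obtain rfl : j = 0 := by omega
      rw [hP1, hP0, M.coeff_add, M.coeff_zero_X_smul, add_zero]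
    | succ k ih =>
      intro i j hj
      rw [hP1 k, hP1 (k + 1), M.coeff_add, M.coeff_add]
      congr 1
      rcases j with _ | j
      · rw [M.coeff_zero_X_smul, M.coeff_zero_X_smul]
      · rw [M.coeff_succ_X_smul, M.coeff_succ_X_smul]
        exact M.coeff_subst_congr (hPm k) (hPm (k + 1)) ih (H i) (by omega)
  have stable (j d : ℕ) (i : σ) : M.coeff j (P (j + d) i) = M.coeff j (P j i) := by
    induction d with
    | zero => rfl
    | succ d ih => rw [← add_assoc, ← step (j + d) i j (by omega), ih]
  -- The t-adic limit: the coefficient of t^m no longer changes from `P m` on.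
  choose G hG using fun i => M.exists_coeff fun m => M.coeff m (P m i)
  have hGm (i : σ) : G i ∈ M.fil 1 := by
    rw [M.mem_fil]
    intro m
    rw [hG]
    exact (M.mem_fil _ _).1 (hPm m i) m
  refine ⟨G, hGm, fun i => M.ext _ _ fun m => ?_⟩
  rw [hG, M.coeff_add]
  rcases m with _ | m
  · rw [hP0, M.coeff_zero_X_smul, add_zero]
  · rw [hP1, M.coeff_add, M.coeff_succ_X_smul, M.coeff_succ_X_smul]
    congr 1
    refine M.coeff_subst_congr (m := m + 1) (hPm m) hGm (fun i j hj => ?_) _ (Nat.lt_succ_self m)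
    obtain ⟨d, rfl⟩ := Nat.exists_eq_add_of_le (Nat.lt_succ_iff.1 hj)
    rw [hG, stable]

/-- `F` and `G` are mutually inverse formal maps without constant terms. -/
def IsInverse (F G : σ → T) : Prop :=
  (∀ i, F i ∈ M.fil 1) ∧ (∀ i, G i ∈ M.fil 1) ∧
    (∀ i, M.subst F (G i) = M.X i) ∧ (∀ i, M.subst G (F i) = M.X i)

theorem IsInverse.unique {M : SeriesModel σ K A T} {F G G' : σ → T} (h : M.IsInverse F G)
    (h' : M.IsInverse F G') : G' = G := by
  funext i
  rw [← M.subst_subst_of_inverse h.1 h.2.1 h.2.2.2 (G' i), h'.2.2.1, X, M.subst_var G h.2.1]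

theorem subst_sub_X_smul {G : σ → T} (hG : ∀ i, G i ∈ M.fil 1) (H : σ → T) (i : σ) :
    M.subst G (M.X i - (PowerSeries.X : K⟦X⟧) • H i) =
      G i - (PowerSeries.X : K⟦X⟧) • M.subst G (H i) := by
  refine ((M.substHom G hG).map_sub _ _).trans ?_
  change M.subst G (M.X i) - M.subst G ((PowerSeries.X : K⟦X⟧) • H i) = _
  rw [X, M.subst_var G hG, M.subst_smul G hG]

/-- The inverse of `z - t H(z)`. -/
theorem exists_isInverse (H : σ → T) (hH : ∀ i, H i ∈ M.fil 1) :
    ∃ G, M.IsInverse (fun i => M.X i - (PowerSeries.X : K⟦X⟧) • H i) G := by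
  have right (H : σ → T) (hH : ∀ i, H i ∈ M.fil 1) : ∃ G : σ → T, (∀ i, G i ∈ M.fil 1) ∧
      (∀ i, M.subst G (M.X i - (PowerSeries.X : K⟦X⟧) • H i) = M.X i) ∧
      ∀ i, G i = M.X i + (PowerSeries.X : K⟦X⟧) • M.subst G (H i) := by
    obtain ⟨G, hG, e⟩ := M.exists_fixed_point H hH
    refine ⟨G, hG, fun i => ?_, e⟩
    rw [M.subst_sub_X_smul hG, sub_eq_iff_eq_add]
    exact e i
  have hF (i : σ) : M.X i - (PowerSeries.X : K⟦X⟧) • H i ∈ M.fil 1 :=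
    sub_mem (M.var_mem i) (M.fil_smul _ _ _ (hH i))
  obtain ⟨G, hG, hFG, e⟩ := right H hH
  -- `right` gives only F(G) = z. But G = z - t(-H(G)) has the same shape as F, so it has an `F'`
  -- with G(F') = z.
  obtain ⟨F', hF', hGF', -⟩ := right (fun i => -M.subst G (H i))
    fun i => neg_mem (M.subst_mem G hG (hH i))
  have e' : (fun i => M.X i - (PowerSeries.X : K⟦X⟧) • -M.subst G (H i)) = G := by
    funext i
    rw [smul_neg, sub_neg_eq_add]
    exact (e i).symm
  have hGF (i : σ) : M.subst F' (G i) = M.X i := by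
    rw [← congrFun e' i]
    exact hGF' i
  -- Evaluating F(G(F')) in two ways gives F = F'.
  have hFF' : F' = fun i => M.X i - (PowerSeries.X : K⟦X⟧) • H i := by
    funext i
    have := M.subst_subst_of_inverse hG hF' hGF (M.X i - (PowerSeries.X : K⟦X⟧) • H i)
    rwa [hFG, X, M.subst_var F' hF'] at this
  exact ⟨G, hF, hG, fun i => hFF' ▸ hGF i, hFG⟩

theorem exists_eq_incl_add (v : T) :
    ∃ v' : T, v = M.incl (M.coeff 0 v) + (PowerSeries.X : K⟦X⟧) • v' := by
  obtain ⟨v', hv'⟩ := M.exists_eq_X_pow_smul (m := 1) (f := v - M.incl (M.coeff 0 v))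
    fun j hj => by
      obtain rfl : j = 0 := by omega
      rw [M.coeff_sub, M.coeff_zero_incl, sub_self]
  refine ⟨v', ?_⟩
  rw [pow_one] at hv'
  rw [← hv']
  abel

/-- Expand `v` in powers of t and use K[[t]]-linearity of substitution. As t-adic continuity is not
among the axioms, one power of t is peeled off at a time. -/
theorem coeff_subst_eq_sum {G : σ → T} (hG : ∀ i, G i ∈ M.fil 1) (m : ℕ) (v : T) :
    M.coeff m (M.subst G v) =
      ∑ j ∈ Finset.range (m + 1), M.coeff j (M.subst G (M.incl (M.coeff (m - j) v))) := by
  obtain ⟨v', hv⟩ := M.exists_eq_incl_add v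
  induction m generalizing v v' with
  | zero =>
    rw [Finset.sum_range_one]
    conv_lhs => rw [hv, M.subst_add G hG, M.coeff_add, M.subst_smul G hG, M.coeff_zero_X_smul,
      add_zero]
  | succ m ih =>
    obtain ⟨v'', hv'⟩ := M.exists_eq_incl_add v'
    have hc (j : ℕ) : M.coeff j v' = M.coeff (j + 1) v := by
      conv_rhs => rw [hv, M.coeff_add, M.coeff_succ_incl, M.coeff_succ_X_smul, zero_add]
    rw [Finset.sum_range_succ, Nat.sub_self]
    conv_lhs => rw [hv, M.subst_add G hG, M.coeff_add, M.subst_smul G hG, M.coeff_succ_X_smul,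
      ih v' v'' hv']
    rw [add_comm]
    congr 1
    refine Finset.sum_congr rfl fun j hj => ?_
    rw [Finset.mem_range] at hj
    rw [hc, show m - j + 1 = m + 1 - j by omega]

/-! ### The flow equation of the inverse map and its coefficients. -/

/-- The formal map `z - t H(z)`. -/
noncomputable def deform (H : σ → A) : σ → T :=
  fun i => M.X i - (PowerSeries.X : K⟦X⟧) • M.incl (H i)

/-- The vector field `(∂M_t/∂t)(F_t)`, where `G_t = z + M_t(z)`. -/
def field (F G : σ → T) (i : σ) : T := M.subst F (M.deriv (G i - M.X i))

section Inversion

variable {M} {H : σ → A} {G : σ → T} (hG : M.IsInverse (M.deform H) G)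

include hG

theorem IsInverse.eq_add (i : σ) :
    G i = M.X i + (PowerSeries.X : K⟦X⟧) • M.subst G (M.incl (H i)) := by
  rw [← sub_eq_iff_eq_add, ← M.subst_sub_X_smul hG.2.1 fun i => M.incl (H i)]
  exact hG.2.2.2 i

/-- Modulo t, G is the identity map; this is B_0 = 1. -/
theorem IsInverse.coeff_zero_subst (f : A) : M.coeff 0 (M.subst G (M.incl f)) = f := by
  rw [M.coeff_subst_congr (m := 1) hG.2.1 M.var_mem (fun i j hj => ?_) _ one_pos]
  · exact (congrArg _ (M.subst_X _)).trans (M.coeff_zero_incl f)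
  · obtain rfl : j = 0 := by omega
    rw [hG.eq_add, M.coeff_add, M.coeff_zero_X_smul, add_zero]
    rfl

/-- The F inside u cancels against G. This is the hypothesis on the vector field in the chain rule
`deriv_subst`. -/
theorem IsInverse.subst_field (i : σ) :
    M.subst G (M.field (M.deform H) G i) = M.deriv (G i) := by
  rw [field, M.subst_subst_of_inverse hG.1 hG.2.1 hG.2.2.2]
  refine (M.derivHom.map_sub _ _).trans ?_
  change M.deriv (G i) - M.deriv (M.X i) = _
  rw [M.deriv_X, sub_zero]

/-- The flow equation: the chain rule, whose term with ∂f/∂t drops out. -/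
theorem IsInverse.deriv_subst_incl (f : A) :
    M.deriv (M.subst G (M.incl f)) =
      M.subst G (M.der (M.field (M.deform H) G) (M.incl f)) := by
  rw [M.deriv_subst hG.2.1 hG.subst_field]
  have h₁ : M.deriv (M.incl f) = 0 := by
    refine M.ext _ _ fun m => ?_
    rw [M.coeff_deriv, M.coeff_succ_incl, smul_zero, M.coeff_zero]
  have h₂ : M.subst G 0 = 0 := (M.substHom G hG.2.1).map_zero
  rw [h₁, h₂, zero_add]

/-- The vector field `u` of the flow satisfies `u = H + t [u ∂/∂z] H`. -/
theorem IsInverse.field_eq (i : σ) :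
    M.field (M.deform H) G i = M.incl (H i) +
      (PowerSeries.X : K⟦X⟧) • M.der (M.field (M.deform H) G) (M.incl (H i)) := by
  -- After substitution of G both sides equal ∂G_i/∂t, the right one by differentiating G = z +
  -- tH(G). Substitution of F then removes G.
  have e : M.subst G (M.field (M.deform H) G i) = M.subst G (M.incl (H i) +
      (PowerSeries.X : K⟦X⟧) • M.der (M.field (M.deform H) G) (M.incl (H i))) := by
    rw [hG.subst_field, M.subst_add G hG.2.1, M.subst_smul G hG.2.1, ← hG.deriv_subst_incl]
    conv_lhs => rw [hG.eq_add, M.deriv_add, M.deriv_X, M.deriv_smul, zero_add]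
    simp
  have inv := M.subst_subst_of_inverse hG.2.1 hG.1 hG.2.2.1
  rw [← inv (M.field (M.deform H) G i), e, inv]

theorem IsInverse.coeff_zero_field (i : σ) : M.coeff 0 (M.field (M.deform H) G i) = H i := by
  rw [hG.field_eq, M.coeff_add, M.coeff_zero_incl, M.coeff_zero_X_smul, add_zero]

theorem IsInverse.coeff_succ_field (k : ℕ) (i : σ) :
    M.coeff (k + 1) (M.field (M.deform H) G i) =
      M.derA (fun i => M.coeff k (M.field (M.deform H) G i)) (H i) := by
  conv_lhs => rw [hG.field_eq, M.coeff_add, M.coeff_succ_incl, M.coeff_succ_X_smul, zero_add,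
    M.coeff_der_incl]

theorem IsInverse.coeff_field (C : ℕ → σ → A) (h₀ : C 0 = H)
    (hC : ∀ k, C (k + 1) = fun i => M.derA (C k) (H i)) (k : ℕ) :
    (fun i => M.coeff k (M.field (M.deform H) G i)) = C k := by
  induction k with
  | zero =>
    funext i
    rw [hG.coeff_zero_field, h₀]
  | succ k ih =>
    funext i
    rw [hG.coeff_succ_field, ih, hC]

/-- The expansion of the inverse map along compositions. -/
theorem IsInverse.coeff_eq_sum [Algebra ℚ K] (ψ : ℕ → Module.End K A)
    (hψ : ∀ k f, ψ k f = M.coeff (k - 1) (M.der (M.field (M.deform H) G) (M.incl f)))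
    (m : ℕ) (i : σ) :
    M.coeff m (G i) = ∑ I : Composition m, algebraMap ℚ K (1 / (I.piU : ℚ)) •
      (I.blocks.map ψ).prod (M.var i) := by
  -- The coefficient of t^m in the operator f ↦ f(G_t).
  let B : ℕ → Module.End K A := fun m =>
    { toFun := fun f => M.coeff m (M.subst G (M.incl f))
      map_add' := fun f g => by rw [M.incl_add, M.subst_add G hG.2.1, M.coeff_add]
      map_smul' := fun c f => by
        rw [M.incl_smul, M.subst_smul G hG.2.1, M.coeff_C_smul, RingHom.id_apply] }
  have hB (m : ℕ) (f : A) : B m f = M.coeff m (M.subst G (M.incl f)) := rfl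
  have key := Composition.sum_piU_of_recursion (K := K) ψ B
    (LinearMap.ext fun f => hG.coeff_zero_subst f) (fun m => ?_) m
  · have := LinearMap.congr_fun key (M.var i)
    rw [hB, M.subst_var G hG.2.1] at this
    simpa [LinearMap.sum_apply] using this
  -- The recursion is the coefficient of t^m in the flow equation; ψ_k belongs to t^(k-1), hence the
  -- index m + 1 - j.
  · refine LinearMap.ext fun f => ?_
    rw [LinearMap.smul_apply, hB, ← M.coeff_deriv, hG.deriv_subst_incl,
      M.coeff_subst_eq_sum hG.2.1, LinearMap.sum_apply]
    refine Finset.sum_congr rfl fun j hj => ?_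
    rw [Finset.mem_range] at hj
    rw [Module.End.mul_apply, hB, hψ, show m + 1 - j - 1 = m - j by omega]

theorem IsInverse.coeff_zero (i : σ) : M.coeff 0 (G i) = M.var i := by
  rw [← hG.coeff_zero_subst (M.var i), M.subst_var G hG.2.1]

end Inversion

theorem existsUnique_isInverse (H : σ → A) (hH : ∀ i, M.incl (H i) ∈ M.fil 1) :
    ∃! G, M.IsInverse (M.deform H) G := by
  obtain ⟨G, hG⟩ := M.exists_isInverse (fun i => M.incl (H i)) hH
  exact ⟨G, hG, fun G' hG' => IsInverse.unique hG hG'⟩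

end SeriesModel

/-! ### Noncommuting variables: order, substitution, and the framework's axioms. -/

namespace NCPowerSeries

section Filtration

variable {σ : Type*} {R : Type*} [CommRing R]

/-- The series of order at least `N`. -/
def fil (σ R : Type*) [CommRing R] (N : ℕ) : AddSubgroup (NCPowerSeries σ R) where
  carrier := {f | ∀ w : List σ, w.length < N → coeff w f = 0}
  add_mem' {f g} hf hg w hw := by rw [coeff_add, hf w hw, hg w hw, add_zero]
  zero_mem' w _ := coeff_zero w
  neg_mem' {f} hf w hw := by
    have : coeff w (-f) = -coeff w f := rfl
    rw [this, hf w hw, neg_zero]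

theorem mem_fil {N : ℕ} {f : NCPowerSeries σ R} :
    f ∈ fil σ R N ↔ ∀ w : List σ, w.length < N → coeff w f = 0 := Iff.rfl

theorem mem_fil_one {f : NCPowerSeries σ R} : f ∈ fil σ R 1 ↔ constantCoeff f = 0 := by
  rw [mem_fil]
  refine ⟨fun h => h [] Nat.one_pos, fun h w hw => ?_⟩
  obtain rfl := List.length_eq_zero_iff.1 (Nat.lt_one_iff.1 hw)
  exact h

theorem mul_mem_fil {N : ℕ} {f g : NCPowerSeries σ R} (hf : f ∈ fil σ R 1) (hg : g ∈ fil σ R N) :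
    f * g ∈ fil σ R (N + 1) := by
  intro w hw
  rw [coeff_mul]
  refine Finset.sum_eq_zero fun k hk => ?_
  rcases k with _ | k
  · rw [List.take_zero, hf [] Nat.one_pos, zero_mul]
  · rw [Finset.mem_range] at hk
    rw [hg _ (by rw [List.length_drop]; omega), mul_zero]

theorem smul_mem_fil {N : ℕ} (c : R) {f : NCPowerSeries σ R} (hf : f ∈ fil σ R N) :
    c • f ∈ fil σ R N := by
  intro w hw
  rw [coeff_smul, hf w hw, smul_zero]

theorem eq_zero_of_forall_mem_fil {f : NCPowerSeries σ R} (h : ∀ N, f ∈ fil σ R N) : f = 0 := by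
  ext w
  exact h (w.length + 1) w (Nat.lt_succ_self _)

theorem coeff_sub (f g : NCPowerSeries σ R) (w : List σ) :
    coeff w (f - g) = coeff w f - coeff w g := rfl

theorem X_mem_fil (i : σ) : (X i : NCPowerSeries σ R) ∈ fil σ R 1 := by
  rw [mem_fil_one]
  simp [constantCoeff, X]

theorem shift_singleton_X [DecidableEq σ] (i j : σ) :
    shift [j] (X i : NCPowerSeries σ R) = if j = i then 1 else 0 := by
  ext w
  by_cases hj : j = i <;> cases w <;> simp [X, hj]

theorem shift_singleton_one (j : σ) : shift [j] (1 : NCPowerSeries σ R) = 0 := by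
  ext w
  exact coeff_one_cons j w

/-- A series without constant term is a combination of the variables. -/
theorem eq_sum_X_mul_shift [Fintype σ] {f : NCPowerSeries σ R} (hf : f ∈ fil σ R 1) :
    f = ∑ i, X i * shift [i] f := by
  classical
  ext w
  rw [coeff_sum]
  cases w with
  | nil =>
    rw [show coeff [] f = 0 from mem_fil_one.1 hf]
    simp [X]
  | cons x w =>
    simp only [coeff_mul_cons, shift_singleton_X]
    rw [Finset.sum_eq_single x] <;> simp +contextual [X, eq_comm]

end Filtration

section Subst

variable {σ : Type*} {R : Type*} [CommRing R] {F : σ → NCPowerSeries σ R}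

theorem prod_mem_fil (hF : ∀ i, F i ∈ fil σ R 1) (v : List σ) :
    (v.map F).prod ∈ fil σ R v.length := by
  induction v with
  | nil => exact fun w hw => absurd hw (Nat.not_lt_zero _)
  | cons i v ih =>
    rw [List.map_cons, List.prod_cons]
    exact mul_mem_fil (hF i) ih

variable [Fintype σ]

/-- The part of the substitution that comes from words of length less than `N`. -/
noncomputable def substTrunc (N : ℕ) (F : σ → NCPowerSeries σ R) (u : NCPowerSeries σ R) :
    NCPowerSeries σ R :=
  ∑ k ∈ Finset.range N, ∑ v : Fin k → σ,
    coeff (List.ofFn v) u • ((List.ofFn v).map F).prod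

/-- The cutoff in `subst` varies with the word `w`. A uniform cutoff turns it into a finite sum in
the ring; the extra words are too long to contribute at `w`. -/
theorem coeff_subst_eq_coeff_substTrunc (hF : ∀ i, F i ∈ fil σ R 1) (u : NCPowerSeries σ R)
    {N : ℕ} {w : List σ} (hw : w.length < N) :
    coeff w (subst F u) = coeff w (substTrunc N F u) := by
  simp only [substTrunc, coeff_sum, coeff_smul, smul_eq_mul]
  refine Finset.sum_subset (Finset.range_subset_range.2 hw) fun k _ hk => ?_
  refine Finset.sum_eq_zero fun v _ => ?_
  rw [Finset.mem_range, not_lt] at hk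
  rw [prod_mem_fil hF _ w (by rw [List.length_ofFn]; omega), mul_zero]

theorem substTrunc_succ (N : ℕ) (u : NCPowerSeries σ R) :
    substTrunc (N + 1) F u =
      coeff [] u • (1 : NCPowerSeries σ R) + ∑ i, F i * substTrunc N F (shift [i] u) := by
  rw [substTrunc, Finset.sum_range_succ', add_comm]
  congr 1
  · simp
  · simp only [substTrunc, Finset.mul_sum]
    rw [Finset.sum_comm]
    refine Finset.sum_congr rfl fun k _ => ?_
    rw [← (Fin.consEquiv fun _ : Fin (k + 1) => σ).sum_comp, Fintype.sum_prod_type]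
    refine Finset.sum_congr rfl fun i _ => Finset.sum_congr rfl fun v _ => ?_
    simp [Fin.consEquiv, List.ofFn_succ]

/-- Sort the words by first letter. The values of `subst` at 1 and at the variables, and its
multiplicativity, follow from this recursion. -/
theorem subst_eq_add_sum (hF : ∀ i, F i ∈ fil σ R 1) (u : NCPowerSeries σ R) :
    subst F u = coeff [] u • (1 : NCPowerSeries σ R) + ∑ i, F i * subst F (shift [i] u) := by
  ext w
  -- One unit of the cutoff is spent on the first letter; the remaining `w.length + 1` suffices for
  -- every suffix of `w`.
  rw [coeff_subst_eq_coeff_substTrunc hF u (N := w.length + 1 + 1) (by omega), substTrunc_succ,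
    coeff_add, coeff_add, coeff_sum, coeff_sum]
  congr 1
  refine Finset.sum_congr rfl fun i _ => ?_
  rw [coeff_mul, coeff_mul]
  refine Finset.sum_congr rfl fun k _ => ?_
  rw [coeff_subst_eq_coeff_substTrunc hF _ (N := w.length + 1) (by rw [List.length_drop]; omega)]

theorem subst_add (F : σ → NCPowerSeries σ R) (u v : NCPowerSeries σ R) :
    subst F (u + v) = subst F u + subst F v := by
  ext w
  simp [subst, add_mul, Finset.sum_add_distrib]

theorem subst_smul (F : σ → NCPowerSeries σ R) (c : R) (u : NCPowerSeries σ R) :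
    subst F (c • u) = c • subst F u := by
  ext w
  simp [subst, Finset.mul_sum, mul_assoc]

theorem subst_zero (F : σ → NCPowerSeries σ R) : subst F (0 : NCPowerSeries σ R) = 0 := by
  ext w
  simp [subst]

theorem subst_one (hF : ∀ i, F i ∈ fil σ R 1) : subst F (1 : NCPowerSeries σ R) = 1 := by
  rw [subst_eq_add_sum hF]
  simp [shift_singleton_one, subst_zero]

theorem subst_X (hF : ∀ i, F i ∈ fil σ R 1) (i : σ) : subst F (X i) = F i := by
  classical
  rw [subst_eq_add_sum hF, Finset.sum_eq_single i]
  · rw [shift_singleton_X, if_pos rfl, subst_one hF, mul_one]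
    simp [X]
  · intro j _ hj
    simp [shift_singleton_X, hj, subst_zero]
  · simp

theorem subst_mul (hF : ∀ i, F i ∈ fil σ R 1) (u v : NCPowerSeries σ R) :
    subst F (u * v) = subst F u * subst F v := by
  rw [← sub_eq_zero]
  refine eq_zero_of_forall_mem_fil fun N => ?_
  induction N generalizing u with
  | zero => exact fun w hw => absurd hw (Nat.not_lt_zero _)
  | succ N ih =>
    -- The defect passes from `u` to its shifts with a factor `F i` of positive order, so its order
    -- in z grows without bound.
    have e : subst F (u * v) - subst F u * subst F v =
        ∑ i, F i * (subst F (shift [i] u * v) - subst F (shift [i] u) * subst F v) := by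
      rw [subst_eq_add_sum hF (u * v), subst_eq_add_sum hF u, add_mul, Finset.sum_mul, smul_mul_assoc,
        one_mul]
      -- Only the `subst F v` multiplied by the constant term of `u` is expanded.
      conv_lhs => enter [2, 1]; rw [subst_eq_add_sum hF v]
      simp only [shift_mul, subst_add, subst_smul, mul_add, mul_sub, Finset.sum_add_distrib,
        Finset.sum_sub_distrib, smul_add, Finset.smul_sum, coeff_mul_nil, smul_smul, mul_smul_comm,
        mul_assoc]
      abel
    rw [e]
    exact sum_mem fun i _ => mul_mem_fil (hF i) (ih _)

end Subst

section Model

variable {σ : Type*} {K : Type*} [CommRing K]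

open scoped PowerSeries

theorem coeff_incl (f : NCPowerSeries σ K) (w : List σ) :
    coeff w (incl f) = PowerSeries.C (coeff w f) := rfl

theorem coeff_tCoeff (m : ℕ) (f : NCPowerSeries σ K⟦X⟧) (w : List σ) :
    coeff w (tCoeff m f) = PowerSeries.coeff m (coeff w f) := rfl

theorem coeff_tDeriv (f : NCPowerSeries σ K⟦X⟧) (w : List σ) :
    coeff w (tDeriv f) = PowerSeries.derivative K (coeff w f) := rfl

theorem incl_X (i : σ) : incl (X i : NCPowerSeries σ K) = X i := by
  ext w : 1
  rw [coeff_incl]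
  simp only [X, coeff_mk]
  split_ifs <;> simp

theorem tCoeff_mul_incl (m : ℕ) (f : NCPowerSeries σ K⟦X⟧) (g : NCPowerSeries σ K) :
    tCoeff m (f * incl g) = tCoeff m f * g := by
  ext w
  simp [coeff_tCoeff, coeff_mul, coeff_incl]

theorem tCoeff_der_incl [Fintype σ] (m : ℕ) (u : σ → NCPowerSeries σ K⟦X⟧)
    (f : NCPowerSeries σ K) :
    tCoeff m (der u (incl f)) = der (fun i => tCoeff m (u i)) f := by
  ext w
  rw [coeff_tCoeff, coeff_der, coeff_der, map_sum]
  refine Finset.sum_congr rfl fun k _ => ?_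
  rw [map_sum]
  refine Finset.sum_congr rfl fun i _ => ?_
  rw [← tCoeff_mul_incl]
  rfl

theorem tDeriv_mul (f g : NCPowerSeries σ K⟦X⟧) :
    tDeriv (f * g) = tDeriv f * g + f * tDeriv g := by
  ext w : 1
  rw [coeff_tDeriv, coeff_add, coeff_mul, coeff_mul, coeff_mul, map_sum, ← Finset.sum_add_distrib]
  refine Finset.sum_congr rfl fun k _ => ?_
  rw [Derivation.leibniz, coeff_tDeriv, coeff_tDeriv, smul_eq_mul, smul_eq_mul]
  ring

variable (σ K) in
/-- Power series in noncommutative variables. -/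
noncomputable def model [Fintype σ] :
    SeriesModel σ K (NCPowerSeries σ K) (NCPowerSeries σ K⟦X⟧) where
  var := X
  incl := incl
  coeff m := tCoeff m
  deriv := tDeriv
  fil := fil σ K⟦X⟧
  filA := fil σ K
  subst := subst
  der u := der u
  derA u := der u
  smul_mul := NCPowerSeries.smul_mul
  mul_smul := NCPowerSeries.mul_smul'
  incl_add := map_add incl
  incl_smul c f := by
    ext w : 1
    simp [coeff_incl, PowerSeries.smul_eq_C_mul]
  coeff_add m := map_add (tCoeff m)
  coeff_C_smul m c f := by
    ext w
    simp [coeff_tCoeff]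
  coeff_zero_incl a := by
    ext w
    simp [coeff_tCoeff, coeff_incl]
  coeff_succ_incl m a := by
    ext w
    simp [coeff_tCoeff, coeff_incl, PowerSeries.coeff_succ_C]
  coeff_zero_X_smul f := by
    ext w
    simp [coeff_tCoeff]
  coeff_succ_X_smul m f := by
    ext w
    simp [coeff_tCoeff, PowerSeries.coeff_succ_X_mul]
  ext f g h := by
    ext w : 1
    ext m
    exact congrArg (coeff w) (h m)
  exists_coeff a := ⟨mk fun w => PowerSeries.mk fun m => coeff w (a m), fun m => by
    ext w
    simp [coeff_tCoeff]⟩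
  mem_fil N f := by
    refine ⟨fun h m w hw => ?_, fun h w hw => ?_⟩
    · rw [coeff_tCoeff, h w hw, map_zero]
    · ext m
      exact h m w hw
  fil_zero f w hw := absurd hw (Nat.not_lt_zero _)
  filA_separated a := eq_zero_of_forall_mem_fil
  fil_mul N f g := mul_mem_fil
  fil_smul N c f := smul_mem_fil c
  var_mem i := by
    rw [incl_X]
    exact X_mem_fil i
  exists_const f := ⟨constantCoeff f, by
    rw [mem_fil_one]
    simp [constantCoeff, coeff_sub]⟩
  exists_sum f hf := ⟨fun i => shift [i] f, by
    simp only [incl_X]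
    exact eq_sum_X_mul_shift hf⟩
  subst_add F _ := subst_add F
  subst_mul F := subst_mul
  subst_smul F _ := subst_smul F
  subst_one F := subst_one
  subst_var F hF i := by rw [incl_X, subst_X hF]
  der_add u := map_add (der u)
  der_mul := der_mul
  der_smul u := map_smul (der u)
  der_var u i := by rw [incl_X, der_X]
  coeff_der_incl := tCoeff_der_incl
  deriv_add f g := by
    ext w : 1
    simp [coeff_tDeriv]
  deriv_mul := tDeriv_mul
  deriv_smul c f := by
    ext w : 1
    simp [coeff_tDeriv]
    ring
  coeff_deriv m f := by
    ext w
    simp [coeff_tCoeff, coeff_tDeriv, PowerSeries.coeff_derivative]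
    ring

variable [Fintype σ]

theorem model_X : (model σ K).X = X := funext incl_X

theorem model_deform (H : σ → NCPowerSeries σ K) : (model σ K).deform H = deform H := by
  funext i
  rw [SeriesModel.deform, model_X]
  rfl

theorem model_isInverse (F G : σ → NCPowerSeries σ K⟦X⟧) :
    (model σ K).IsInverse F G ↔ IsInverse F G := by
  rw [SeriesModel.IsInverse, model_X]
  simp only [IsInverse, ← mem_fil_one]
  rfl

theorem model_field (F G : σ → NCPowerSeries σ K⟦X⟧) :
    (model σ K).field F G = fun i => subst F (tDeriv (G i - X i)) := by
  funext i
  rw [SeriesModel.field, model_X]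
  rfl

theorem existsUnique_isInverse {H : σ → NCPowerSeries σ K} (hH : ∀ i, constantCoeff (H i) = 0) :
    ∃! G, IsInverse (deform H) G := by
  simp only [← model_isInverse, ← model_deform]
  refine (model σ K).existsUnique_isInverse H fun i => mem_fil_one.2 ?_
  rw [constantCoeff, show coeff [] ((model σ K).incl (H i)) = PowerSeries.C (coeff [] (H i)) from rfl,
    show coeff [] (H i) = 0 from hH i, map_zero]

variable {H : σ → NCPowerSeries σ K} {G : σ → NCPowerSeries σ K⟦X⟧}

theorem IsInverse.model (hG : IsInverse (deform H) G) :
    (model σ K).IsInverse ((NCPowerSeries.model σ K).deform H) G := by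
  rwa [model_isInverse, model_deform]

theorem psi_apply (F G : σ → NCPowerSeries σ K⟦X⟧) (k : ℕ) (f : NCPowerSeries σ K) :
    psi F G k f = tCoeff (k - 1) (der (fun i => subst F (tDeriv (G i - X i))) (incl f)) := rfl

theorem IsInverse.tCoeff_eq_sum [Algebra ℚ K] (hG : IsInverse (deform H) G) (m : ℕ) (i : σ) :
    tCoeff m (G i) = ∑ I : Composition m, algebraMap ℚ K (1 / (I.piU : ℚ)) •
      (I.blocks.map (psi (deform H) G)).prod (X i) := by
  refine hG.model.coeff_eq_sum _ (fun k f => ?_) m i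
  rw [model_field, model_deform, psi_apply]
  rfl

theorem IsInverse.psi_eq_der (hG : IsInverse (deform H) G) (k : ℕ) :
    psi (deform H) G k = der (Cvec H (k - 1)) := by
  refine LinearMap.ext fun f => ?_
  rw [psi_apply, tCoeff_der_incl]
  have := hG.model.coeff_field (Cvec H) rfl (fun _ => rfl) (k - 1)
  rw [model_field, model_deform] at this
  exact congrArg (fun u => der u f) this

end Model

end NCPowerSeries

/-! ### Commuting variables: order, the framework's axioms, and the Jacobian form. -/

namespace CommSeries

section Filtration

variable {σ : Type*} {R : Type*} [CommRing R]

/-- The series of order at least `N`. -/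
def fil (σ R : Type*) [CommRing R] (N : ℕ) : AddSubgroup (MvPowerSeries σ R) where
  carrier := {f | ∀ e : σ →₀ ℕ, e.degree < N → MvPowerSeries.coeff e f = 0}
  add_mem' {f g} hf hg e he := by rw [map_add, hf e he, hg e he, add_zero]
  zero_mem' e _ := map_zero _
  neg_mem' {f} hf e he := by rw [map_neg, hf e he, neg_zero]

theorem mem_fil_one {f : MvPowerSeries σ R} :
    f ∈ fil σ R 1 ↔ MvPowerSeries.constantCoeff f = 0 := by
  refine ⟨fun h => h 0 (by simp), fun h e he => ?_⟩
  obtain rfl := (Finsupp.degree_eq_zero_iff e).1 (Nat.lt_one_iff.1 he)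
  exact h

theorem mul_mem_fil {N : ℕ} {f g : MvPowerSeries σ R} (hf : f ∈ fil σ R 1) (hg : g ∈ fil σ R N) :
    f * g ∈ fil σ R (N + 1) := by
  classical
  intro e he
  rw [MvPowerSeries.coeff_mul]
  refine Finset.sum_eq_zero fun p hp => ?_
  rw [Finset.HasAntidiagonal.mem_antidiagonal] at hp
  rcases Nat.eq_zero_or_pos p.1.degree with h | h
  · rw [hf _ (h ▸ Nat.one_pos), zero_mul]
  · have : p.1.degree + p.2.degree = e.degree := by rw [← hp, map_add]
    rw [hg _ (by omega), mul_zero]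

theorem smul_mem_fil {N : ℕ} (c : R) {f : MvPowerSeries σ R} (hf : f ∈ fil σ R N) :
    c • f ∈ fil σ R N := by
  intro e he
  rw [map_smul, hf e he, smul_zero]

theorem eq_zero_of_forall_mem_fil {f : MvPowerSeries σ R} (h : ∀ N, f ∈ fil σ R N) : f = 0 := by
  ext e
  exact h (e.degree + 1) e (Nat.lt_succ_self _)

/-- A series without constant term is a combination of the variables. -/
theorem exists_eq_sum_X_mul [Fintype σ] {f : MvPowerSeries σ R} (hf : f ∈ fil σ R 1) :
    ∃ g : σ → MvPowerSeries σ R, f = ∑ i, MvPowerSeries.X i * g i := by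
  classical
  have hp (e : σ →₀ ℕ) (he : e ≠ 0) : ∃ i, e i ≠ 0 := by
    by_contra! h
    exact he (Finsupp.ext h)
  -- Assign to each nonconstant monomial one variable dividing it; `g i` collects the terms assigned
  -- to z_i, divided by z_i, so that no term is counted twice.
  choose p hp using hp
  have hg (i : σ) : ∃ g : MvPowerSeries σ R, ∀ d, MvPowerSeries.coeff d g =
      if ∃ h, p (d + Finsupp.single i 1) h = i then
        MvPowerSeries.coeff (d + Finsupp.single i 1) f else 0 := ⟨fun d => _, fun _ => rfl⟩
  choose g hg using hg
  refine ⟨g, ?_⟩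
  ext e
  rw [map_sum]
  simp only [MvPowerSeries.X, MvPowerSeries.coeff_monomial_mul, one_mul, hg]
  by_cases he : e = 0
  · subst he
    rw [hf 0 (by simp), Finset.sum_eq_zero]
    intro i _
    rw [if_neg]
    intro h
    simpa using h i
  · have hle : Finsupp.single (p e he) 1 ≤ e := by
      rw [Finsupp.single_le_iff]
      exact Nat.one_le_iff_ne_zero.2 (hp e he)
    rw [Finset.sum_eq_single (p e he)]
    · simp only [if_pos hle, tsub_add_cancel_of_le hle]
      simp [he]
    · intro i _ hi
      split_ifs with h h'
      · simp only [tsub_add_cancel_of_le h] at h'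
        obtain ⟨_, h'⟩ := h'
        exact absurd h'.symm hi
      · rfl
      · rfl
    · simp

end Filtration

section Model

variable {σ : Type*} {K : Type*} [CommRing K]

theorem hasSubst_of_mem_fil [Finite σ] {R : Type*} [CommRing R] {F : σ → MvPowerSeries σ R}
    (hF : ∀ i, F i ∈ fil σ R 1) : MvPowerSeries.HasSubst F :=
  MvPowerSeries.hasSubst_of_constantCoeff_zero fun i => mem_fil_one.1 (hF i)

open scoped PowerSeries

theorem coeff_incl (f : MvPowerSeries σ K) (e : σ →₀ ℕ) :
    MvPowerSeries.coeff e (incl f) = PowerSeries.C (MvPowerSeries.coeff e f) := rfl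

theorem coeff_tCoeff (m : ℕ) (f : MvPowerSeries σ K⟦X⟧) (e : σ →₀ ℕ) :
    MvPowerSeries.coeff e (tCoeff m f) = PowerSeries.coeff m (MvPowerSeries.coeff e f) := rfl

theorem coeff_tDeriv (f : MvPowerSeries σ K⟦X⟧) (e : σ →₀ ℕ) :
    MvPowerSeries.coeff e (tDeriv f) = PowerSeries.derivative K (MvPowerSeries.coeff e f) := rfl

theorem incl_X (i : σ) : incl (MvPowerSeries.X i : MvPowerSeries σ K) = MvPowerSeries.X i :=
  MvPowerSeries.map_X (PowerSeries.C (R := K)) i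

theorem tCoeff_mul_incl (m : ℕ) (f : MvPowerSeries σ K⟦X⟧) (g : MvPowerSeries σ K) :
    tCoeff m (f * incl g) = tCoeff m f * g := by
  classical
  ext e
  simp [coeff_tCoeff, MvPowerSeries.coeff_mul, coeff_incl]

theorem pderiv_incl (i : σ) (f : MvPowerSeries σ K) :
    MvPowerSeries.pderiv K⟦X⟧ i (incl f) = incl (MvPowerSeries.pderiv K i f) := by
  ext e : 1
  simp [MvPowerSeries.coeff_pderiv, coeff_incl]

theorem der_apply [Fintype σ] {R : Type*} [CommRing R] (u : σ → MvPowerSeries σ R)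
    (f : MvPowerSeries σ R) : der u f = ∑ i, u i * MvPowerSeries.pderiv R i f := by
  simp [der, LinearMap.sum_apply]

theorem der_mul [Fintype σ] {R : Type*} [CommRing R] (u : σ → MvPowerSeries σ R)
    (f g : MvPowerSeries σ R) : der u (f * g) = der u f * g + f * der u g := by
  simp only [der_apply, Derivation.leibniz, smul_eq_mul, Finset.sum_mul, Finset.mul_sum,
    ← Finset.sum_add_distrib]
  refine Finset.sum_congr rfl fun i _ => ?_
  ring

theorem der_X [Fintype σ] {R : Type*} [CommRing R] (u : σ → MvPowerSeries σ R) (i : σ) :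
    der u (MvPowerSeries.X i) = u i := by
  classical
  rw [der_apply, Finset.sum_eq_single i]
  · simp
  · intro j _ hj
    rw [MvPowerSeries.pderiv_X_of_ne hj.symm, mul_zero]
  · simp

theorem tCoeff_der_incl [Fintype σ] (m : ℕ) (u : σ → MvPowerSeries σ K⟦X⟧)
    (f : MvPowerSeries σ K) :
    tCoeff m (der u (incl f)) = der (fun i => tCoeff m (u i)) f := by
  simp only [der_apply, map_sum, pderiv_incl, tCoeff_mul_incl]

theorem tDeriv_mul (f g : MvPowerSeries σ K⟦X⟧) :
    tDeriv (f * g) = tDeriv f * g + f * tDeriv g := by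
  classical
  ext e : 1
  rw [coeff_tDeriv, map_add, MvPowerSeries.coeff_mul, MvPowerSeries.coeff_mul,
    MvPowerSeries.coeff_mul, map_sum, ← Finset.sum_add_distrib]
  refine Finset.sum_congr rfl fun k _ => ?_
  rw [Derivation.leibniz, coeff_tDeriv, coeff_tDeriv, smul_eq_mul, smul_eq_mul]
  ring

variable (σ K) in
/-- Power series in commutative variables. -/
noncomputable def model [Fintype σ] :
    SeriesModel σ K (MvPowerSeries σ K) (MvPowerSeries σ K⟦X⟧) where
  var := MvPowerSeries.X
  incl := incl
  coeff m := tCoeff m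
  deriv := tDeriv
  fil := fil σ K⟦X⟧
  filA := fil σ K
  subst := MvPowerSeries.subst
  der u := der u
  derA u := der u
  smul_mul := smul_mul_assoc
  mul_smul c f g := mul_smul_comm c f g
  incl_add := map_add incl
  incl_smul c f := by
    ext e : 1
    simp [coeff_incl, PowerSeries.smul_eq_C_mul]
  coeff_add m := map_add (tCoeff m)
  coeff_C_smul m c f := by
    ext e
    simp [coeff_tCoeff]
  coeff_zero_incl a := by
    ext e
    simp [coeff_tCoeff, coeff_incl]
  coeff_succ_incl m a := by
    ext e
    simp [coeff_tCoeff, coeff_incl, PowerSeries.coeff_succ_C]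
  coeff_zero_X_smul f := by
    ext e
    simp [coeff_tCoeff]
  coeff_succ_X_smul m f := by
    ext e
    simp [coeff_tCoeff, PowerSeries.coeff_succ_X_mul]
  ext f g h := by
    ext e : 1
    ext m
    exact congrArg (MvPowerSeries.coeff e) (h m)
  exists_coeff a := ⟨fun e => PowerSeries.mk fun m => MvPowerSeries.coeff e (a m), fun m => by
    ext e
    exact PowerSeries.coeff_mk m fun m => MvPowerSeries.coeff e (a m)⟩
  mem_fil N f := by
    refine ⟨fun h m e he => ?_, fun h e he => ?_⟩
    · rw [coeff_tCoeff, h e he, map_zero]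
    · ext m
      exact h m e he
  fil_zero f e he := absurd he (Nat.not_lt_zero _)
  filA_separated a := eq_zero_of_forall_mem_fil
  fil_mul N f g := mul_mem_fil
  fil_smul N c f := smul_mem_fil c
  var_mem i := by
    rw [incl_X, mem_fil_one, MvPowerSeries.constantCoeff_X]
  exists_const f := ⟨MvPowerSeries.constantCoeff f, by
    rw [mem_fil_one]
    simp [MvPowerSeries.smul_eq_C_mul]⟩
  exists_sum f hf := by
    simp only [incl_X]
    exact exists_eq_sum_X_mul hf
  subst_add F hF := MvPowerSeries.subst_add (hasSubst_of_mem_fil hF)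
  subst_mul F hF := MvPowerSeries.subst_mul (hasSubst_of_mem_fil hF)
  subst_smul F hF := MvPowerSeries.subst_smul (hasSubst_of_mem_fil hF)
  subst_one F hF := by
    rw [← MvPowerSeries.coe_substAlgHom (hasSubst_of_mem_fil hF), map_one]
  subst_var F hF i := by rw [incl_X, MvPowerSeries.subst_X (hasSubst_of_mem_fil hF)]
  der_add u := map_add (der u)
  der_mul := der_mul
  der_smul u := map_smul (der u)
  der_var u i := by rw [incl_X, der_X]
  coeff_der_incl := tCoeff_der_incl
  deriv_add f g := by
    ext e : 1
    simp [coeff_tDeriv]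
  deriv_mul := tDeriv_mul
  deriv_smul c f := by
    ext e : 1
    simp [coeff_tDeriv]
    ring
  coeff_deriv m f := by
    ext e
    simp [coeff_tCoeff, coeff_tDeriv, PowerSeries.coeff_derivative]
    ring

variable [Fintype σ]

theorem model_X : (model σ K).X = MvPowerSeries.X := funext incl_X

theorem model_deform (H : σ → MvPowerSeries σ K) : (model σ K).deform H = deform H := by
  funext i
  rw [SeriesModel.deform, model_X]
  rfl

theorem model_isInverse (F G : σ → MvPowerSeries σ K⟦X⟧) :
    (model σ K).IsInverse F G ↔ IsInverse F G := by
  rw [SeriesModel.IsInverse, model_X]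
  simp only [IsInverse, ← mem_fil_one]
  rfl

theorem model_field (F G : σ → MvPowerSeries σ K⟦X⟧) :
    (model σ K).field F G =
      fun i => MvPowerSeries.subst F (tDeriv (G i - MvPowerSeries.X i)) := by
  funext i
  rw [SeriesModel.field, model_X]
  rfl

theorem existsUnique_isInverse {H : σ → MvPowerSeries σ K}
    (hH : ∀ i, MvPowerSeries.constantCoeff (H i) = 0) : ∃! G, IsInverse (deform H) G := by
  simp only [← model_isInverse, ← model_deform]
  refine (model σ K).existsUnique_isInverse H fun i => mem_fil_one.2 ?_
  refine (MvPowerSeries.constantCoeff_map (PowerSeries.C (R := K)) (H i)).trans ?_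
  rw [hH, map_zero]

variable {H : σ → MvPowerSeries σ K} {G : σ → MvPowerSeries σ K⟦X⟧}

theorem IsInverse.model (hG : IsInverse (deform H) G) :
    (model σ K).IsInverse ((CommSeries.model σ K).deform H) G := by
  rwa [model_isInverse, model_deform]

theorem psi_apply (F G : σ → MvPowerSeries σ K⟦X⟧) (k : ℕ) (f : MvPowerSeries σ K) :
    psi F G k f = tCoeff (k - 1)
      (der (fun i => MvPowerSeries.subst F (tDeriv (G i - MvPowerSeries.X i))) (incl f)) := rfl

theorem IsInverse.tCoeff_eq_sum [Algebra ℚ K] (hG : IsInverse (deform H) G) (m : ℕ) (i : σ) :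
    tCoeff m (G i) = ∑ I : Composition m, algebraMap ℚ K (1 / (I.piU : ℚ)) •
      (I.blocks.map (psi (deform H) G)).prod (MvPowerSeries.X i) := by
  refine hG.model.coeff_eq_sum _ (fun k f => ?_) m i
  rw [model_field, model_deform, psi_apply]
  rfl

theorem IsInverse.psi_eq_der (hG : IsInverse (deform H) G) (k : ℕ) :
    psi (deform H) G k = der (Cvec H (k - 1)) := by
  refine LinearMap.ext fun f => ?_
  rw [psi_apply, tCoeff_der_incl]
  have := hG.model.coeff_field (Cvec H) rfl (fun _ => rfl) (k - 1)
  rw [model_field, model_deform] at this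
  exact congrArg (fun u => der u f) this

/-- In commuting variables [C ∂/∂z]H_i = ∑ C_j ∂H_i/∂z_j is the i-th entry of JH·C, so each step of
the recursion multiplies by JH. -/
theorem Cvec_eq_jacobian_pow_mulVec [DecidableEq σ] (H : σ → MvPowerSeries σ K) (k : ℕ) :
    Cvec H k = (jacobian H ^ k).mulVec H := by
  induction k with
  | zero => rw [pow_zero, Matrix.one_mulVec, Cvec]
  | succ k ih =>
    rw [pow_succ', ← Matrix.mulVec_mulVec, ← ih]
    funext i
    refine (der_apply _ _).trans ?_
    rw [Matrix.mulVec, dotProduct]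
    refine Finset.sum_congr rfl fun j _ => ?_
    rw [mul_comm, jacobian, Matrix.of_apply]

end Model

end CommSeries

/-! ### The theorem for both kinds of variables. -/

theorem mainTheorem6 {K : Type*} [CommRing K] [Algebra ℚ K] (n : ℕ) :
    -- noncommutative variables
    (∀ H : Fin n → NCPowerSeries (Fin n) K,
      (∀ i, NCPowerSeries.constantCoeff (H i) = 0) →
      (∃! G, NCPowerSeries.IsInverse (NCPowerSeries.deform H) G) ∧
      ∀ G, NCPowerSeries.IsInverse (NCPowerSeries.deform H) G →
        (∀ i, NCPowerSeries.tCoeff 0 (G i) = NCPowerSeries.X i) ∧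
        (∀ m, 1 ≤ m → ∀ i,
          NCPowerSeries.tCoeff m (G i) =
            ∑ I : Composition m, algebraMap ℚ K (1 / (I.piU : ℚ)) •
              (I.blocks.map (NCPowerSeries.psi (NCPowerSeries.deform H) G)).prod
                (NCPowerSeries.X i)) ∧
        (∀ k, 1 ≤ k →
          NCPowerSeries.psi (NCPowerSeries.deform H) G k =
            NCPowerSeries.der (NCPowerSeries.Cvec H (k - 1)))) ∧
    -- commutative variables
    (∀ H : Fin n → MvPowerSeries (Fin n) K,
      (∀ i, MvPowerSeries.constantCoeff (H i) = 0) →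
      (∃! G, CommSeries.IsInverse (CommSeries.deform H) G) ∧
      ∀ G, CommSeries.IsInverse (CommSeries.deform H) G →
        (∀ i, CommSeries.tCoeff 0 (G i) = MvPowerSeries.X i) ∧
        (∀ m, 1 ≤ m → ∀ i,
          CommSeries.tCoeff m (G i) =
            ∑ I : Composition m, algebraMap ℚ K (1 / (I.piU : ℚ)) •
              (I.blocks.map (CommSeries.psi (CommSeries.deform H) G)).prod
                (MvPowerSeries.X i)) ∧
        (∀ k, 1 ≤ k →
          CommSeries.psi (CommSeries.deform H) G k =
              CommSeries.der (CommSeries.Cvec H (k - 1)) ∧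
            CommSeries.psi (CommSeries.deform H) G k =
              CommSeries.der ((CommSeries.jacobian H ^ (k - 1)).mulVec H))) := by
  refine ⟨fun H hH => ⟨NCPowerSeries.existsUnique_isInverse hH, fun G hG =>
      ⟨fun i => hG.model.coeff_zero i, fun m _ i => hG.tCoeff_eq_sum m i,
        fun k _ => hG.psi_eq_der k⟩⟩,
    fun H hH => ⟨CommSeries.existsUnique_isInverse hH, fun G hG =>
      ⟨fun i => hG.model.coeff_zero i, fun m _ i => hG.tCoeff_eq_sum m i,
        fun k _ => ⟨hG.psi_eq_der k, ?_⟩⟩⟩⟩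
  rw [hG.psi_eq_der, CommSeries.Cvec_eq_jacobian_pow_mulVec]
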